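/- Conventions. For $t\in\mathbb R$ and a function $u$ on $\mathbb R^n$ put $D^t u=\mathcal F_n^{-1}\,|\omega|^t\,\mathcal F_n u$, where $\mathcal F_n$ is the Fourier transform on $\mathbb R^n$ and $\omega$ the (angular) frequency variable; this is written $D_{rz}^t$ on $\mathbb R^2$ with coordinates $(r,z)$ and $D_{xyz}^t$ on $\mathbb R^3$ with coordinates $(x,y,z)$. We say that $D^tu$ converges absolutely if $u\in L^1(\mathbb R^n)$ and $|\omega|^t\mathcal F_n u\in L^1(\mathbb R^n)$. Let $L^2_{rz}=L^2((0,\infty)\times\mathbb R,\;dr\,dz)$ (complex valued). A function $g(r,z)$ on $r>0$ is identified with the axially symmetric function $g(\sqrt{x^2+y^2},z)$ on $\mathbb R^3$, and $D_{xyz}^{t}$ of an axially symmetric function, which is again axially symmetric, is regarded as a function of $(r,z)\in\mathbb R^2$ that is even in $r$. For $s\in\mathbb R$ let $\mathcal D_s$ be the set of $f\in L^2_{rz}$ for which $u=D_{xyz}^{-s}(r^{-1/2}f)$ (on $\mathbb R^3$) and then $D_{rz}^s u$ (on $\mathbb R^2$) converge absolutely. **Lemma (fractional derivative conversion).** Let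 $0\le s\le 2$. Then the composition $$r^{1/2}\,D_{rz}^s\,D_{xyz}^{-s}\,r^{-1/2}$$ is bounded as an operator $L^2_{rz}\to L^2_{rz}$. That is, its domain $\mathcal D_s$ is dense in $L^2_{rz}$, and there is a bounded linear operator $U:L^2_{rz}\to L^2_{rz}$ such that, for every $f\in\mathcal D_s$, $Uf=r^{1/2}D_{rz}^sD_{xyz}^{-s}r^{-1/2}f$ almost everywhere on $r>0$. -/

import Mathlib

open MeasureTheory
open scoped FourierTransform ENNReal

noncomputable section

namespace AxialFrac

/-- The plane `ℝ²` with Euclidean norm; the coordinates are `(r, z)`. -/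
abbrev Plane : Type := EuclideanSpace ℝ (Fin 2)

/-- The space `ℝ³` with Euclidean norm; the coordinates are `(x, y, z)`. -/
abbrev Space : Type := EuclideanSpace ℝ (Fin 3)

/-- The measure `dr dz` on the half-plane `r > 0`. -/
def halfPlaneMeasure : Measure Plane :=
  (volume : Measure Plane).restrict {p | 0 < p 0}

/-- `L²_{rz}`: complex square-integrable functions of `(r, z)`, `r > 0`, for the measure `dr dz`. -/
abbrev L2rz : Type := Lp ℂ 2 halfPlaneMeasure

section FracDeriv

variable {V : Type} [NormedAddCommGroup V] [InnerProductSpace ℝ V] [FiniteDimensional ℝ V]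
  [MeasurableSpace V] [BorelSpace V]

/-- `|ω|^t û` where `ω = 2πξ` is the angular frequency: the Fourier transform `𝓕` uses the
character `exp (-2πi⟨x, ξ⟩)`, so that `2π‖ξ‖` is the symbol of `(-Δ)^{1/2}`. -/
def fracSymbolMul (t : ℝ) (u : V → ℂ) : V → ℂ :=
  fun ξ => (((2 * Real.pi * ‖ξ‖) ^ t : ℝ) : ℂ) * 𝓕 u ξ

/-- The fractional derivative `D^t = 𝓕⁻¹ |ω|^t 𝓕` of real order `t` on a Euclidean space. -/
def fracDeriv (t : ℝ) (u : V → ℂ) : V → ℂ :=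
  𝓕⁻ (fracSymbolMul t u)

/-- The two integrals that define `D^t u` converge absolutely. -/
def FracDerivConverges (t : ℝ) (u : V → ℂ) : Prop :=
  Integrable u ∧ Integrable (fracSymbolMul t u)

end FracDeriv

/-- The axially symmetric function on `ℝ³` with profile `f(r, z)`, `r = √(x² + y²)`. -/
def axialExt (f : Plane → ℂ) : Space → ℂ :=
  fun x => f !₂[Real.sqrt (x 0 ^ 2 + x 1 ^ 2), x 2]

/-- An axially symmetric function on `ℝ³`, viewed as a function of `(r, z)` that is extended to
`ℝ²` evenly in `r`. -/
def axialProfile (u : Space → ℂ) : Plane → ℂ :=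
  fun p => u !₂[|p 0|, 0, p 1]

/-- The axially symmetric function `r^{-1/2} f` on `ℝ³`. -/
def weightedExt (f : Plane → ℂ) : Space → ℂ :=
  axialExt fun p => ((p 0 ^ (-(1 / 2) : ℝ) : ℝ) : ℂ) * f p

/-- `D_{xyz}^{-s} r^{-1/2} f` as a function on `ℝ²`, even in `r`. -/
def innerPart (s : ℝ) (f : Plane → ℂ) : Plane → ℂ :=
  axialProfile (fracDeriv (-s) (weightedExt f))

/-- The composition `r^{1/2} D_{rz}^s D_{xyz}^{-s} r^{-1/2} f`, as a function of `(r, z)`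
(used only for `r > 0`). -/
def conversion (s : ℝ) (f : Plane → ℂ) : Plane → ℂ :=
  fun p => ((p 0 ^ (1 / 2 : ℝ) : ℝ) : ℂ) * fracDeriv s (innerPart s f) p

/-- The `f ∈ L²_{rz}` for which all the integrals in the composition
`r^{1/2} D_{rz}^s D_{xyz}^{-s} r^{-1/2} f` converge absolutely. -/
def conversionDomain (s : ℝ) : Set L2rz :=
  {f | FracDerivConverges (-s) (weightedExt f) ∧ FracDerivConverges s (innerPart s f)}

end AxialFrac

end

/-!
Let `f ∈ L²(dr dz)` and let `g = 𝓕₃ (r^{-1/2} f)`, a function of the frequencies `(k, ζ)`, where `k`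
is the radial one. Since `dx dy dz = r dr dz dθ`, the map `f ↦ k^{1/2} g` is unitary on `L²(dr dz)`
(`lintegral_fourier_weightedExt_sq`).

The conversion is bounded as soon as its pairings with test functions `φ` on `r > 0` are bounded by
`C ‖f‖ ‖φ‖` (`exists_Lp_of_integral_test_le`). The restriction to the plane `y = 0` of a function on
`ℝ³` has as Fourier transform the integrals of the `ℝ³` transform over the lines parallel to the
`y` axis (`fourier_axialProfile_ae_eq`). In cylindrical coordinates the pairing therefore becomes
`∫ g(k, ζ) M(k, ζ) k dk dζ` (`integral_conversion_mul`), where, with `Ψ = 𝓕₂⁻¹ (r^{1/2} φ)`,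
  `M(k, ζ) = ∫ ((k² cos² θ + ζ²) / (k² + ζ²))^{s/2} Ψ(k cos θ, ζ) dθ`.
The same integral without the power is `N(k, ζ) = ∫ Ψ(k cos θ, ζ) dθ = 𝓕₃⁻¹ (r^{-1/2} φ)(k, ζ)`
(`fourierInv_weightedExt_eq_circAvg`), and its norm in `L²(k dk dζ)` is `‖φ‖`. So what has to be
proved is that `N ↦ M` is bounded on `L²(k dk)`, uniformly in `ζ`
(`exists_lintegral_symbolRatio_sq_le`).

Integrate by parts in `y = |cos θ|`. For `s ≤ 2` the derivative of the power is at most `s y^{s-1}`,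
uniformly in `k` and `ζ` (`symbolRatioDeriv_le`), so `|M|` is at most `|N|` plus the integral of
`s y^{s-1}` against the modulus of the part `|cos θ| < y` of the integral `N`. That part is not a
circular average, but Abel inversion (`lintegral_abelMeasure_arcsineMeasure`, which rests on the
elementary integral `lintegral_abel_kernel`) writes it as a weighted average of `N(k x, ζ)` over
`0 < x < y`.
This bounds `|M|` by `|N|` and by iterated averages of dilates of `|N|`, which are bounded on
`L²(k dk)` by Schur's test (`lintegral_dilAvg_sq_le`); their norm is finite since
`(1 - y²)^{-1/2}` and, for `s > 0`, `y^{s-1} (1 - y²)^{-1/2}` are integrable on `(0, 1)`. For `s = 0` one has `M = N`.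

For the density of the domain (`dense_conversionDomain`), the functions whose `ℝ³` Fourier transform
is an axially symmetric test function away from the axis lie in the domain: there `|ω|^{-s}` is
smooth, so `D_{xyz}^{-s}` yields a Schwartz function, whose restriction to the plane is Schwartz.
Such functions are dense because the transform is unitary.
-/

noncomputable section

namespace AxialFrac

open scoped ContDiff

set_option linter.unusedSectionVars false

/-! ### Fourier transforms of integrable functions -/

section Fourier

variable {V : Type} [NormedAddCommGroup V] [InnerProductSpace ℝ V] [FiniteDimensional ℝ V]
  [MeasurableSpace V] [BorelSpace V]

lemma continuous_fourier {f : V → ℂ} (hf : Integrable f) : Continuous (𝓕 f) :=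
  VectorFourier.fourierIntegral_continuous Real.continuous_fourierChar continuous_inner hf

lemma continuous_fourierInv {f : V → ℂ} (hf : Integrable f) : Continuous (𝓕⁻ f) := by
  have h : 𝓕⁻ f = fun w => 𝓕 f (-w) := funext (Real.fourierInv_eq_fourier_neg f)
  rw [h]
  exact (continuous_fourier hf).comp continuous_neg

lemma integral_fourier_mul {f g : V → ℂ} (hf : Integrable f) (hg : Integrable g) :
    ∫ w, 𝓕 f w * g w = ∫ x, f x * 𝓕 g x := by
  have h := VectorFourier.integral_fourierIntegral_smul_eq_flip (L := innerₗ V)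
    Real.continuous_fourierChar continuous_inner hf hg
  rw [flip_innerₗ] at h
  exact h

lemma integral_fourierInv_mul {f g : V → ℂ} (hf : Integrable f) (hg : Integrable g) :
    ∫ w, 𝓕⁻ f w * g w = ∫ x, f x * 𝓕⁻ g x := by
  have hg' : Integrable fun w => g (-w) := hg.comp_neg
  have e : 𝓕⁻ g = 𝓕 fun w => g (-w) := Real.fourierInv_eq_fourier_comp_neg g
  rw [e, ← integral_fourier_mul hf hg', ← integral_neg_eq_self]
  simp [Real.fourierInv_eq_fourier_neg]

/-- A compactly supported smooth real function, as a complex Schwartz function. -/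
def schwartzOfReal (φ : V → ℝ) (hφ : ContDiff ℝ ∞ φ) (hc : HasCompactSupport φ) :
    SchwartzMap V ℂ :=
  HasCompactSupport.toSchwartzMap (f := fun x => (φ x : ℂ))
    (hc.comp_left (g := fun t : ℝ => (t : ℂ)) (by simp)) (Complex.ofRealCLM.contDiff.comp hφ)

lemma schwartzOfReal_apply (φ : V → ℝ) (hφ : ContDiff ℝ ∞ φ) (hc : HasCompactSupport φ) (x : V) :
    schwartzOfReal φ hφ hc x = (φ x : ℂ) := rfl

/-- Functions are determined almost everywhere by their pairings with Schwartz functions. -/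
lemma ae_eq_of_integral_schwartz {f g : V → ℂ} (hf : LocallyIntegrable f)
    (hg : LocallyIntegrable g)
    (h : ∀ χ : SchwartzMap V ℂ, ∫ x, f x * χ x = ∫ x, g x * χ x) : f =ᵐ[volume] g := by
  refine ae_eq_of_integral_contDiff_smul_eq hf hg fun φ hφ hc => ?_
  have := h (schwartzOfReal φ hφ hc)
  simpa [schwartzOfReal_apply, mul_comm] using this

/-- Fourier inversion for an integrable function with integrable inverse transform, without
continuity of the function. -/
lemma fourier_fourierInv_ae_eq {H : V → ℂ} (hH : Integrable H) (hH' : Integrable (𝓕⁻ H)) :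
    𝓕 (𝓕⁻ H) =ᵐ[volume] H := by
  refine ae_eq_of_integral_schwartz (continuous_fourier hH').locallyIntegrable
    hH.locallyIntegrable fun χ => ?_
  rw [integral_fourier_mul hH' χ.integrable]
  have e : 𝓕 (χ : V → ℂ) = (𝓕 χ : SchwartzMap V ℂ) := (SchwartzMap.fourier_coe χ).symm
  rw [e, integral_fourierInv_mul hH (𝓕 χ).integrable, ← SchwartzMap.fourierInv_coe]
  simp

lemma coeFn_fourier_toLp_ae_eq {f : V → ℂ} (hf : Integrable f) (hf2 : MemLp f 2) :
    ((𝓕 (hf2.toLp f) : Lp ℂ 2 (volume : Measure V)) : V → ℂ) =ᵐ[volume] 𝓕 f := by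
  refine ae_eq_of_integral_schwartz ((Lp.memLp _).locallyIntegrable (by norm_num))
    (continuous_fourier hf).locallyIntegrable fun χ => ?_
  have h := congrArg (fun T => T χ) (Lp.fourier_toTemperedDistribution_eq (hf2.toLp f))
  simp only [TemperedDistribution.fourier_apply, Lp.toTemperedDistribution_apply] at h
  rw [integral_fourier_mul hf χ.integrable]
  simp only [smul_eq_mul] at h
  calc _ = ∫ x, χ x * (𝓕 (hf2.toLp f) : Lp ℂ 2 (volume : Measure V)) x := by
        simp_rw [mul_comm]
    _ = ∫ x, (𝓕 χ) x * (hf2.toLp f) x := h.symm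
    _ = _ := by
      refine integral_congr_ae ?_
      filter_upwards [hf2.coeFn_toLp] with x hx
      rw [hx, mul_comm]
      rfl

/-- Plancherel's theorem for functions in `L¹ ∩ L²` and the Fourier integral. -/
lemma eLpNorm_fourier {f : V → ℂ} (hf : Integrable f) (hf2 : MemLp f 2) :
    eLpNorm (𝓕 f) 2 = eLpNorm f 2 := by
  have h := Lp.norm_fourier_eq (hf2.toLp f)
  rw [← eLpNorm_congr_ae (coeFn_fourier_toLp_ae_eq hf hf2), ← eLpNorm_congr_ae hf2.coeFn_toLp]
  rw [Lp.norm_def, Lp.norm_def] at h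
  exact (ENNReal.toReal_eq_toReal_iff' (Lp.eLpNorm_ne_top _) (Lp.eLpNorm_ne_top _)).1 h

lemma eLpNorm_fourierInv {f : V → ℂ} (hf : Integrable f) (hf2 : MemLp f 2) :
    eLpNorm (𝓕⁻ f) 2 = eLpNorm f 2 := by
  have mp : MeasurePreserving (fun x : V => -x) := Measure.measurePreserving_neg volume
  rw [Real.fourierInv_eq_fourier_comp_neg, eLpNorm_fourier hf.comp_neg
    (hf2.comp_measurePreserving mp)]
  exact eLpNorm_comp_measurePreserving hf2.1 mp

end Fourier

/-! ### Duality with test functions on an open set -/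

section Test

variable {V : Type} [NormedAddCommGroup V] [NormedSpace ℝ V] [FiniteDimensional ℝ V]
  [MeasurableSpace V] [BorelSpace V]

/-- `φ` is a complex test function on `U`: smooth, with compact support inside `U`. -/
structure IsTest (U : Set V) (φ : V → ℂ) : Prop where
  contDiff : ContDiff ℝ ∞ φ
  hasCompactSupport : HasCompactSupport φ
  tsupport_subset : tsupport φ ⊆ U

variable {U : Set V} {φ ψ : V → ℂ} {μ : Measure V} [IsFiniteMeasureOnCompacts μ]

lemma IsTest.add (hφ : IsTest U φ) (hψ : IsTest U ψ) : IsTest U (φ + ψ) :=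
  ⟨hφ.1.add hψ.1, hφ.2.add hψ.2, (tsupport_add φ ψ).trans (Set.union_subset hφ.3 hψ.3)⟩

lemma IsTest.const_smul (c : ℂ) (hφ : IsTest U φ) : IsTest U (c • φ) :=
  ⟨hφ.1.const_smul c, hφ.2.smul_left (f := fun _ => c),
    (tsupport_smul_subset_right (fun _ => c) φ).trans hφ.3⟩

lemma IsTest.ofReal {g : V → ℝ} (h1 : ContDiff ℝ ∞ g) (h2 : HasCompactSupport g)
    (h3 : tsupport g ⊆ U) : IsTest U (fun x => (g x : ℂ)) :=
  ⟨Complex.ofRealCLM.contDiff.comp h1, h2.comp_left (g := fun t : ℝ => (t : ℂ)) (by simp),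
    (closure_mono (Function.support_comp_subset (g := fun t : ℝ => (t : ℂ)) (by simp) g)).trans h3⟩

lemma IsTest.memLp (hφ : IsTest U φ) : MemLp φ 2 μ :=
  hφ.1.continuous.memLp_of_hasCompactSupport hφ.2

variable (U μ) in
/-- The classes of the test functions on `U` in `L²`. -/
def testSubmodule : Submodule ℂ (Lp ℂ 2 μ) where
  carrier := {F | ∃ φ, IsTest U φ ∧ F =ᵐ[μ] φ}
  add_mem' := by
    rintro F G ⟨φ, hφ, hF⟩ ⟨ψ, hψ, hG⟩
    exact ⟨φ + ψ, hφ.add hψ, (Lp.coeFn_add F G).trans (hF.add hG)⟩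
  zero_mem' := ⟨0, ⟨contDiff_const, HasCompactSupport.zero, by simp [tsupport]⟩, Lp.coeFn_zero _ _ _⟩
  smul_mem' := by
    rintro c F ⟨φ, hφ, hF⟩
    exact ⟨c • φ, hφ.const_smul c, (Lp.coeFn_smul c F).trans (hF.const_smul c)⟩

/-- A locally integrable function on `U` that annihilates all test functions vanishes. -/
lemma ae_eq_zero_of_integral_test (hU : IsOpen U) {c : V → ℂ}
    (hc : LocallyIntegrableOn c U μ)
    (h : ∀ φ, IsTest U φ → ∫ x in U, c x * φ x ∂μ = 0) : c =ᵐ[μ.restrict U] 0 := by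
  have := hU.ae_eq_zero_of_integral_contDiff_smul_eq_zero hc fun g h1 h2 h3 => by
    rw [← h _ (IsTest.ofReal h1 h2 h3), setIntegral_eq_integral_of_forall_compl_eq_zero]
    · refine integral_congr_ae (.of_forall fun x => ?_)
      simp [mul_comm]
    · intro x hx
      have : g x = 0 := image_eq_zero_of_notMem_tsupport fun h => hx (h3 h)
      simp [this]
  exact (ae_restrict_iff' hU.measurableSet).2 this

lemma dense_testSubmodule (hU : IsOpen U) :
    Dense (testSubmodule U (μ.restrict U) : Set (Lp ℂ 2 (μ.restrict U))) := by
  rw [Submodule.dense_iff_topologicalClosure_eq_top, Submodule.topologicalClosure_eq_top_iff,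
    Submodule.eq_bot_iff]
  intro F hF
  rw [Lp.eq_zero_iff_ae_eq_zero]
  have hloc : LocallyIntegrableOn (fun x => star (F x)) U μ := by
    have h2 : LocallyIntegrableOn (F : V → ℂ) U μ := by
      refine (locallyIntegrableOn_iff hU.isLocallyClosed).2 fun K hK hKc => ?_
      have h3 : LocallyIntegrable (F : V → ℂ) (μ.restrict U) :=
        (Lp.memLp F).locallyIntegrable (by norm_num)
      have := h3.integrableOn_isCompact hKc
      rwa [IntegrableOn, Measure.restrict_restrict hKc.measurableSet,
        Set.inter_eq_left.2 hK] at this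
    intro x hx
    obtain ⟨s, hs, hi⟩ := h2 x hx
    exact ⟨s, hs, by simpa using! (LinearIsometryEquiv.integrable_comp_iff Complex.conjLIE).2 hi⟩
  have := ae_eq_zero_of_integral_test hU hloc fun φ hφ => by
    have h1 := (Submodule.mem_orthogonal' _ _).1 hF (hφ.memLp.toLp φ)
      ⟨φ, hφ, hφ.memLp.coeFn_toLp⟩
    rw [L2.inner_def] at h1
    rw [← h1]
    refine integral_congr_ae ?_
    filter_upwards [(hφ.memLp (μ := μ.restrict U)).coeFn_toLp] with x hx
    rw [hx]
    simp [mul_comm]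
  filter_upwards [this] with x hx
  simpa using hx

/-- A locally integrable function whose pairing with test functions is bounded in `L²` norm is
itself in `L²`, with the same bound. -/
lemma exists_Lp_of_integral_test_le (hU : IsOpen U) {c : V → ℂ}
    (hc : LocallyIntegrableOn c U μ) {C : ℝ} (hC : 0 ≤ C)
    (h : ∀ φ, IsTest U φ → ‖∫ x in U, c x * φ x ∂μ‖ ≤ C * (eLpNorm φ 2 (μ.restrict U)).toReal) :
    ∃ F : Lp ℂ 2 (μ.restrict U), F =ᵐ[μ.restrict U] c ∧ ‖F‖ ≤ C := by
  have hint : ∀ φ, IsTest U φ → Integrable (fun x => c x * φ x) (μ.restrict U) := fun φ hφ => by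
    have h1 : IntegrableOn c (tsupport φ) μ := hc.integrableOn_compact_subset hφ.3 hφ.2
    obtain ⟨B, hB⟩ := hφ.2.exists_bound_of_continuous hφ.1.continuous
    have h2 : IntegrableOn (fun x => c x * φ x) (tsupport φ) μ :=
      h1.mul_bdd hφ.1.continuous.aestronglyMeasurable (.of_forall hB)
    refine (integrableOn_iff_integrable_of_support_subset ?_).1 h2 |>.restrict
    exact fun x hx => subset_tsupport φ fun h0 => hx (by simp [h0])
  let S := testSubmodule U (μ.restrict U)
  have key : ∀ F : S, ∀ φ, (F : Lp ℂ 2 (μ.restrict U)) =ᵐ[μ.restrict U] φ →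
      ∫ x in U, c x * (F : Lp ℂ 2 (μ.restrict U)) x ∂μ = ∫ x in U, c x * φ x ∂μ :=
    fun F φ hF => integral_congr_ae (by filter_upwards [hF] with x hx; rw [hx])
  have hint' : ∀ F : S, Integrable (fun x => c x * (F : Lp ℂ 2 (μ.restrict U)) x)
      (μ.restrict U) := fun F => by
    obtain ⟨φ, hφ, hF⟩ := F.2
    exact (hint φ hφ).congr (by filter_upwards [hF] with x hx; rw [hx])
  let L : S →ₗ[ℂ] ℂ :=
    { toFun := fun F => ∫ x in U, c x * (F : Lp ℂ 2 (μ.restrict U)) x ∂μ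
      map_add' := fun F G => by
        rw [← integral_add (hint' F) (hint' G)]
        refine integral_congr_ae ?_
        filter_upwards [Lp.coeFn_add (F : Lp ℂ 2 (μ.restrict U)) G] with x hx
        rw [Submodule.coe_add, hx, Pi.add_apply, mul_add]
      map_smul' := fun a F => by
        simp only [RingHom.id_apply, smul_eq_mul]
        rw [← integral_const_mul]
        refine integral_congr_ae ?_
        filter_upwards [Lp.coeFn_smul a (F : Lp ℂ 2 (μ.restrict U))] with x hx
        simp [hx]
        ring }
  have hL : ∀ F, ‖L F‖ ≤ C * ‖F‖ := fun F => by
    obtain ⟨φ, hφ, hF⟩ := F.2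
    have := h φ hφ
    rw [← key F φ hF, ← eLpNorm_congr_ae hF] at this
    exact this
  obtain ⟨T, hT, hTn⟩ := exists_extension_norm_eq S (L.mkContinuous C hL)
  have hTC : ‖T‖ ≤ C := hTn ▸ L.mkContinuous_norm_le hC hL
  set G := (InnerProductSpace.toDual ℂ (Lp ℂ 2 (μ.restrict U))).symm T with hG
  have hconj : MemLp (fun x => star (G x)) 2 (μ.restrict U) := (Lp.memLp G).star
  refine ⟨hconj.toLp _, ?_, ?_⟩
  · have hloc : LocallyIntegrableOn (fun x => star (G x)) U μ := by
      refine (locallyIntegrableOn_iff hU.isLocallyClosed).2 fun K hK hKc => ?_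
      have := (hconj.locallyIntegrable (by norm_num)).integrableOn_isCompact hKc
      rwa [IntegrableOn, Measure.restrict_restrict hKc.measurableSet,
        Set.inter_eq_left.2 hK] at this
    have h0 := ae_eq_zero_of_integral_test hU (hloc.sub hc) fun φ hφ => by
      have hφ2 : MemLp φ 2 (μ.restrict U) := hφ.memLp
      have e1 : T (hφ2.toLp φ) = ∫ x in U, c x * φ x ∂μ := by
        have hm : hφ2.toLp φ ∈ S := ⟨φ, hφ, hφ2.coeFn_toLp⟩
        rw [← key ⟨_, hm⟩ φ hφ2.coeFn_toLp]
        exact hT ⟨_, hm⟩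
      have e2 : T (hφ2.toLp φ) = ∫ x in U, star (G x) * φ x ∂μ := by
        rw [← InnerProductSpace.toDual_symm_apply, ← hG, L2.inner_def]
        refine integral_congr_ae ?_
        filter_upwards [hφ2.coeFn_toLp] with x hx
        rw [hx]
        simp [mul_comm]
      have hi2 : Integrable (fun x => star (G x) * φ x) (μ.restrict U) := hconj.integrable_mul hφ2
      have : ∀ x, ((fun x => star (G x)) - c) x * φ x = star (G x) * φ x - c x * φ x :=
        fun x => by simp [sub_mul]
      simp_rw [this]
      rw [integral_sub hi2 (hint φ hφ), ← e1, ← e2, sub_self]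
    filter_upwards [hconj.coeFn_toLp, h0] with x hx h0x
    rw [hx]
    exact sub_eq_zero.1 h0x
  · have : ‖hconj.toLp _‖ = ‖G‖ := by
      rw [Lp.norm_toLp, Lp.norm_def]
      congr 1
      exact eLpNorm_congr_norm_ae (.of_forall fun x => by simp)
    rw [this, hG, LinearIsometryEquiv.norm_map]
    exact hTC

end Test

/-! ### Cylindrical coordinates -/

/-- The coordinates of `Plane`, as a map to `ℝ × ℝ`. -/
def planeCoord : Plane ≃ᵐ ℝ × ℝ :=
  (MeasurableEquiv.toLp 2 (Fin 2 → ℝ)).symm.trans MeasurableEquiv.finTwoArrow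

lemma planeCoord_apply (p : Plane) : planeCoord p = (p 0, p 1) := rfl

lemma planeCoord_symm_apply (q : ℝ × ℝ) : planeCoord.symm q = !₂[q.1, q.2] := by
  rw [MeasurableEquiv.symm_apply_eq, planeCoord_apply]
  simp

lemma measurePreserving_planeCoord : MeasurePreserving planeCoord :=
  (EuclideanSpace.volume_preserving_symm_measurableEquiv_toLp (Fin 2)).trans
    (volume_preserving_finTwoArrow ℝ)

/-- Splitting off one coordinate of `Space`. -/
def spaceCoord (i : Fin 3) : Space ≃ᵐ ℝ × Plane :=
  ((MeasurableEquiv.toLp 2 (Fin 3 → ℝ)).symm.trans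
    (MeasurableEquiv.piFinSuccAbove (fun _ => ℝ) i)).trans
    ((MeasurableEquiv.refl ℝ).prodCongr (MeasurableEquiv.toLp 2 (Fin 2 → ℝ)))

lemma measurePreserving_spaceCoord (i : Fin 3) : MeasurePreserving (spaceCoord i) := by
  refine ((EuclideanSpace.volume_preserving_symm_measurableEquiv_toLp (Fin 3)).trans
    (volume_preserving_piFinSuccAbove (fun _ => ℝ) i)).trans ?_
  exact (MeasurePreserving.id volume).prod
    (EuclideanSpace.volume_preserving_symm_measurableEquiv_toLp (Fin 2)).symm

lemma spaceCoord_one_symm_apply (η : ℝ) (p : Plane) :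
    (spaceCoord 1).symm (η, p) = !₂[p 0, η, p 1] := by
  rw [MeasurableEquiv.symm_apply_eq]
  refine Prod.ext rfl ?_
  ext j
  fin_cases j <;> rfl

lemma spaceCoord_two_symm_apply (z : ℝ) (p : Plane) :
    (spaceCoord 2).symm (z, p) = !₂[p 0, p 1, z] := by
  rw [MeasurableEquiv.symm_apply_eq]
  refine Prod.ext rfl ?_
  ext j
  fin_cases j <;> rfl

/-- The measure `r dr dz` on the half-plane `r > 0`. -/
def cylMeasure : Measure Plane :=
  halfPlaneMeasure.withDensity fun p => ENNReal.ofReal (p 0)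

lemma measurable_coord {n : ℕ} (i : Fin n) : Measurable fun p : EuclideanSpace ℝ (Fin n) => p i :=
  (by fun_prop : Continuous fun p : EuclideanSpace ℝ (Fin n) => p i).measurable

lemma isOpen_halfPlane : IsOpen {p : Plane | 0 < p 0} :=
  isOpen_lt continuous_const (by fun_prop)

lemma measurableSet_halfPlane : MeasurableSet {p : Plane | 0 < p 0} :=
  isOpen_halfPlane.measurableSet

instance : SFinite halfPlaneMeasure := by unfold halfPlaneMeasure; infer_instance

instance : SFinite cylMeasure := by unfold cylMeasure; infer_instance

lemma lintegral_cylMeasure {F : Plane → ℝ≥0∞} (hF : AEMeasurable F halfPlaneMeasure) :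
    ∫⁻ p, F p ∂cylMeasure = ∫⁻ p, ENNReal.ofReal (p 0) * F p ∂halfPlaneMeasure := by
  rw [cylMeasure, lintegral_withDensity_eq_lintegral_mul₀ (by fun_prop) hF]
  rfl

lemma cylMeasure_ac : cylMeasure ≪ halfPlaneMeasure := withDensity_absolutelyContinuous _ _

lemma ae_cylMeasure_pos : ∀ᵐ p ∂cylMeasure, 0 < p 0 :=
  cylMeasure_ac.ae_le (ae_restrict_mem measurableSet_halfPlane)

/-- Integration over the half-plane in the coordinates `r` and `z`. -/
lemma lintegral_halfPlaneMeasure {F : Plane → ℝ≥0∞} (hF : Measurable F) :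
    ∫⁻ p, F p ∂halfPlaneMeasure = ∫⁻ z, ∫⁻ r in Set.Ioi 0, F !₂[r, z] := by
  have h1 : ∫⁻ p, F p ∂halfPlaneMeasure
      = ∫⁻ q in Set.Ioi 0 ×ˢ Set.univ, F !₂[q.1, q.2] := by
    have := measurePreserving_planeCoord.symm.setLIntegral_comp_preimage_emb
      planeCoord.symm.measurableEmbedding F {p | 0 < p 0}
    rw [halfPlaneMeasure, ← this]
    congr 1
    · congr 1
      ext q
      simp [planeCoord_symm_apply]
  rw [h1, Measure.volume_eq_prod, ← Measure.prod_restrict, lintegral_prod_symm']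
  · simp
  · have : (fun q : ℝ × ℝ => F !₂[q.1, q.2]) = F ∘ planeCoord.symm := by
      ext q; rw [Function.comp, planeCoord_symm_apply]
    rw [this]
    exact hF.comp planeCoord.symm.measurable

/-- Cylindrical coordinates `((r, z), θ) ↦ (r cos θ, r sin θ, z)`. -/
def cylMap (q : Plane × ℝ) : Space :=
  !₂[q.1 0 * Real.cos q.2, q.1 0 * Real.sin q.2, q.1 1]

lemma continuous_cylMap : Continuous cylMap := by
  unfold cylMap
  fun_prop

/-- The measure `dθ` on `(-π, π)`. -/
abbrev angleMeasure : Measure ℝ := volume.restrict (Set.Ioo (-Real.pi) Real.pi)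

lemma measurePreserving_cylMap :
    MeasurePreserving cylMap (cylMeasure.prod angleMeasure) volume := by
  refine ⟨continuous_cylMap.measurable, Measure.ext_of_lintegral _ fun F hF => ?_⟩
  rw [lintegral_map hF continuous_cylMap.measurable]
  have hFc : Measurable fun q => F (cylMap q) := hF.comp continuous_cylMap.measurable
  rw [lintegral_prod _ hFc.aemeasurable, lintegral_cylMeasure hFc.lintegral_prod_right'.aemeasurable,
    lintegral_halfPlaneMeasure (by
      exact (ENNReal.measurable_ofReal.comp (measurable_coord 0)).mul hFc.lintegral_prod_right')]
  rw [← (measurePreserving_spaceCoord 2).symm.lintegral_comp_emb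
    (spaceCoord 2).symm.measurableEmbedding F, Measure.volume_eq_prod,
    lintegral_prod (fun a => F ((spaceCoord 2).symm a))
      (hF.comp (spaceCoord 2).symm.measurable).aemeasurable]
  refine lintegral_congr fun z => ?_
  have h1 : ∫⁻ p : Plane, F ((spaceCoord 2).symm (z, p))
      = ∫⁻ q : ℝ × ℝ, F !₂[q.1, q.2, z] := by
    rw [← measurePreserving_planeCoord.symm.lintegral_comp_emb
      planeCoord.symm.measurableEmbedding]
    refine lintegral_congr fun q => ?_
    rw [planeCoord_symm_apply, spaceCoord_two_symm_apply]
    simp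
  rw [h1, ← lintegral_comp_polarCoord_symm, polarCoord_target, Measure.volume_eq_prod,
    ← Measure.prod_restrict, lintegral_prod]
  · refine lintegral_congr fun r => ?_
    have hm : Measurable fun θ : ℝ => F !₂[r * Real.cos θ, r * Real.sin θ, z] :=
      hF.comp (by fun_prop : Continuous fun θ : ℝ =>
        (!₂[r * Real.cos θ, r * Real.sin θ, z] : Space)).measurable
    simp only [cylMap, polarCoord_symm_apply, smul_eq_mul, Matrix.cons_val_zero,
      Matrix.cons_val_one]
    rw [lintegral_const_mul _ hm]
  · have hc : Continuous fun a : ℝ × ℝ =>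
        (!₂[(polarCoord.symm a).1, (polarCoord.symm a).2, z] : Space) := by
      simp only [polarCoord_symm_apply]
      fun_prop
    have := (hF.comp hc.measurable)
    exact ((by fun_prop : Measurable fun a : ℝ × ℝ => ENNReal.ofReal a.1).mul this).aemeasurable

/-- The cylindrical coordinates `(r, z)` of a point of `ℝ³`. -/
def axialCoord (x : Space) : Plane := !₂[Real.sqrt (x 0 ^ 2 + x 1 ^ 2), x 2]

lemma continuous_axialCoord : Continuous axialCoord := by
  unfold axialCoord
  fun_prop

lemma axialExt_eq_comp (f : Plane → ℂ) : axialExt f = f ∘ axialCoord := rfl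

lemma axialCoord_cylMap {p : Plane} (hp : 0 < p 0) (θ : ℝ) : axialCoord (cylMap (p, θ)) = p := by
  have h : (p 0 * Real.cos θ) ^ 2 + (p 0 * Real.sin θ) ^ 2 = p 0 ^ 2 := by
    linear_combination (p 0) ^ 2 * Real.sin_sq_add_cos_sq θ
  ext i
  fin_cases i
  · simp [axialCoord, cylMap, h, Real.sqrt_sq hp.le]
  · simp [axialCoord, cylMap]

/-- The push-forward of the volume of `ℝ³` to the half-plane is `2π r dr dz`. -/
lemma map_axialCoord_volume :
    Measure.map axialCoord volume = ENNReal.ofReal (2 * Real.pi) • cylMeasure := by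
  refine Measure.ext_of_lintegral _ fun F hF => ?_
  have hm := continuous_axialCoord.measurable
  rw [lintegral_map hF hm,
    ← measurePreserving_cylMap.lintegral_comp (f := fun x => F (axialCoord x)) (hF.comp hm),
    lintegral_prod (fun a => F (axialCoord (cylMap a)))
      (hF.comp (hm.comp continuous_cylMap.measurable)).aemeasurable,
    lintegral_smul_measure, smul_eq_mul, ← lintegral_const_mul _ hF]
  refine lintegral_congr_ae ?_
  filter_upwards [ae_cylMeasure_pos] with p hp
  simp only [axialCoord_cylMap hp, lintegral_const, Measure.restrict_apply_univ,
    Real.volume_Ioo]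
  rw [mul_comm]
  congr 2
  ring

lemma quasiMeasurePreserving_axialCoord :
    Measure.QuasiMeasurePreserving axialCoord volume halfPlaneMeasure := by
  refine ⟨continuous_axialCoord.measurable, ?_⟩
  rw [map_axialCoord_volume]
  exact (Measure.smul_absolutelyContinuous).trans cylMeasure_ac

lemma lintegral_axialCoord {F : Plane → ℝ≥0∞} (hF : AEMeasurable F halfPlaneMeasure) :
    ∫⁻ x, F (axialCoord x) = ENNReal.ofReal (2 * Real.pi) * ∫⁻ p, F p ∂cylMeasure := by
  have h1 : AEMeasurable F (Measure.map axialCoord volume) :=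
    hF.mono_ac quasiMeasurePreserving_axialCoord.absolutelyContinuous
  rw [← lintegral_map' h1 continuous_axialCoord.aemeasurable, map_axialCoord_volume,
    lintegral_smul_measure, smul_eq_mul]

lemma eLpNorm_two_sq {α : Type*} [MeasurableSpace α] (μ : Measure α) (f : α → ℂ) :
    eLpNorm f 2 μ ^ 2 = ∫⁻ x, ‖f x‖ₑ ^ 2 ∂μ := by
  rw [eLpNorm_eq_lintegral_rpow_enorm_toReal (by norm_num) (by norm_num), ← ENNReal.rpow_natCast,
    ← ENNReal.rpow_mul]
  simp

lemma weightedExt_congr {f g : Plane → ℂ} (h : f =ᵐ[halfPlaneMeasure] g) :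
    weightedExt f =ᵐ[volume] weightedExt g := by
  have := quasiMeasurePreserving_axialCoord.ae_eq_comp h
  filter_upwards [this] with x hx
  have hx : f (axialCoord x) = g (axialCoord x) := hx
  change _ * f (axialCoord x) = _ * g (axialCoord x)
  rw [hx]

lemma aestronglyMeasurable_weightedExt {f : Plane → ℂ}
    (hf : AEStronglyMeasurable f halfPlaneMeasure) : AEStronglyMeasurable (weightedExt f) := by
  have h1 : Measurable fun p : Plane => ((p 0 ^ (-(1 / 2) : ℝ) : ℝ) : ℂ) := by fun_prop
  exact (h1.aestronglyMeasurable.mul hf).comp_quasiMeasurePreserving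
    quasiMeasurePreserving_axialCoord

lemma enorm_rpow_neg_half_sq {r : ℝ} (hr : 0 < r) :
    ‖((r ^ (-(1 / 2) : ℝ) : ℝ) : ℂ)‖ₑ ^ 2 = ENNReal.ofReal r⁻¹ := by
  rw [← ofReal_norm, Complex.norm_real, Real.norm_of_nonneg (by positivity),
    ← ENNReal.ofReal_pow (by positivity), ← Real.rpow_natCast, ← Real.rpow_mul hr.le]
  norm_num [Real.rpow_neg_one]

lemma enorm_rpow_half_sq {r : ℝ} (hr : 0 < r) :
    ‖((r ^ (1 / 2 : ℝ) : ℝ) : ℂ)‖ₑ ^ 2 = ENNReal.ofReal r := by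
  rw [← ofReal_norm, Complex.norm_real, Real.norm_of_nonneg (by positivity),
    ← ENNReal.ofReal_pow (by positivity), ← Real.rpow_natCast, ← Real.rpow_mul hr.le]
  norm_num

/-- `f ↦ r^{-1/2} f` is `√(2π)` times an isometry from `L²(dr dz)` to `L²(ℝ³)`. -/
lemma lintegral_weightedExt_sq {f : Plane → ℂ} (hf : AEStronglyMeasurable f halfPlaneMeasure) :
    ∫⁻ x, ‖weightedExt f x‖ₑ ^ 2 =
      ENNReal.ofReal (2 * Real.pi) * ∫⁻ p, ‖f p‖ₑ ^ 2 ∂halfPlaneMeasure := by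
  have h1 : Measurable fun p : Plane => ((p 0 ^ (-(1 / 2) : ℝ) : ℝ) : ℂ) := by fun_prop
  have h2 : AEMeasurable (fun p => ‖((p 0 ^ (-(1 / 2) : ℝ) : ℝ) : ℂ) * f p‖ₑ ^ 2)
    halfPlaneMeasure := (h1.aestronglyMeasurable.mul hf).enorm.pow_const 2
  have h3 := lintegral_axialCoord h2
  rw [lintegral_cylMeasure h2] at h3
  refine h3.trans ?_
  congr 1
  refine lintegral_congr_ae ?_
  filter_upwards [ae_restrict_mem measurableSet_halfPlane] with p hp
  have hp : 0 < p 0 := hp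
  rw [enorm_mul, mul_pow, enorm_rpow_neg_half_sq hp, ← mul_assoc, ← ENNReal.ofReal_mul hp.le,
    mul_inv_cancel₀ hp.ne']
  simp

lemma memLp_weightedExt {f : Plane → ℂ} (hf : MemLp f 2 halfPlaneMeasure) :
    MemLp (weightedExt f) 2 := by
  refine ⟨aestronglyMeasurable_weightedExt hf.1, ?_⟩
  have h := hf.2
  have e : ∀ a : ℝ≥0∞, a < ⊤ ↔ a ^ 2 < ⊤ := fun a => by simp
  rw [e, eLpNorm_two_sq] at h ⊢
  rw [lintegral_weightedExt_sq hf.1]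
  exact ENNReal.mul_lt_top ENNReal.ofReal_lt_top h

/-! ### Axially symmetric functions and their Fourier transforms -/

/-- `u` depends only on `(r, z)`. -/
def IsAxial (u : Space → ℂ) : Prop := ∀ x y, axialCoord x = axialCoord y → u x = u y

lemma isAxial_axialExt (f : Plane → ℂ) : IsAxial (axialExt f) := fun x y h => by
  rw [axialExt_eq_comp, Function.comp, Function.comp, h]

lemma norm_eq_of_axialCoord_eq {x y : Space} (h : axialCoord x = axialCoord y) : ‖x‖ = ‖y‖ := by
  have h0 := congrArg (fun p : Plane => p 0) h
  have h1 := congrArg (fun p : Plane => p 1) h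
  simp only [axialCoord, PiLp.toLp_apply, Matrix.cons_val_zero, Matrix.cons_val_one] at h0 h1
  rw [Real.sqrt_inj (by positivity) (by positivity)] at h0
  simp [EuclideanSpace.norm_eq, Fin.sum_univ_three, h0, h1]

/-- Points with the same cylindrical coordinates are exchanged by an isometry that preserves the
cylindrical coordinates: the reflection in the perpendicular bisector. -/
lemma exists_isometry_axial {x y : Space} (h : axialCoord x = axialCoord y) :
    ∃ A : Space ≃ₗᵢ[ℝ] Space, A x = y ∧ ∀ w, axialCoord (A w) = axialCoord w := by
  refine ⟨(Submodule.span ℝ {x - y})ᗮ.reflection,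
    Submodule.reflection_sub (norm_eq_of_axialCoord_eq h), fun w => ?_⟩
  set A := (Submodule.span ℝ {x - y})ᗮ.reflection with hA
  have h1 := congrArg (fun p : Plane => p 1) h
  have h1 : x 2 = y 2 := h1
  have h2 : (A w) 2 = w 2 := by
    have hv : (EuclideanSpace.single 2 (1 : ℝ) : Space) ∈ (Submodule.span ℝ {x - y})ᗮ := by
      rw [Submodule.mem_orthogonal_singleton_iff_inner_right]
      rw [EuclideanSpace.inner_single_right]
      simp [h1]
    have hv' : A (EuclideanSpace.single 2 (1 : ℝ)) = EuclideanSpace.single 2 (1 : ℝ) :=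
      Submodule.reflection_mem_subspace_eq_self hv
    have := A.inner_map_map (EuclideanSpace.single 2 (1 : ℝ)) w
    rw [hv'] at this
    simpa [EuclideanSpace.inner_single_left] using this
  have h3 : (A w) 0 ^ 2 + (A w) 1 ^ 2 = w 0 ^ 2 + w 1 ^ 2 := by
    have := A.norm_map w
    rw [EuclideanSpace.norm_eq, EuclideanSpace.norm_eq, Real.sqrt_inj (by positivity)
      (by positivity)] at this
    simp only [Fin.sum_univ_three, Real.norm_eq_abs, sq_abs, h2] at this
    linarith
  simp [axialCoord, h2, h3]

lemma IsAxial.fourier {u : Space → ℂ} (hu : IsAxial u) : IsAxial (𝓕 u) := fun x y h => by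
  obtain ⟨A, hA, hA'⟩ := exists_isometry_axial h
  rw [← hA, ← Real.fourier_comp_linearIsometry]
  refine congrArg (fun f : Space → ℂ => 𝓕 f x) (funext fun w => ?_)
  exact (hu _ _ (hA' w)).symm

lemma IsAxial.fourierInv {u : Space → ℂ} (hu : IsAxial u) : IsAxial (𝓕⁻ u) := fun x y h => by
  obtain ⟨A, hA, hA'⟩ := exists_isometry_axial h
  rw [← hA, ← Real.fourierInv_comp_linearIsometry]
  refine congrArg (fun f : Space → ℂ => 𝓕⁻ f x) (funext fun w => ?_)
  exact (hu _ _ (hA' w)).symm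

lemma IsAxial.fracSymbolMul {u : Space → ℂ} (hu : IsAxial u) (t : ℝ) :
    IsAxial (fracSymbolMul t u) := fun x y h => by
  simp only [AxialFrac.fracSymbolMul, norm_eq_of_axialCoord_eq h, hu.fourier x y h]

lemma isAxial_weightedExt (f : Plane → ℂ) : IsAxial (weightedExt f) := isAxial_axialExt _

/-- The embedding of the plane `y = 0` in `ℝ³`. -/
def planeEmb (p : Plane) : Space := !₂[p 0, 0, p 1]

lemma continuous_planeEmb : Continuous planeEmb := by
  unfold planeEmb
  fun_prop

lemma axialCoord_planeEmb {p : Plane} (hp : 0 ≤ p 0) : axialCoord (planeEmb p) = p := by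
  ext i
  fin_cases i
  · simp [axialCoord, planeEmb, Real.sqrt_sq hp]
  · simp [axialCoord, planeEmb]

lemma IsAxial.axialProfile_eq {u : Space → ℂ} (hu : IsAxial u) :
    axialProfile u = u ∘ planeEmb := by
  ext p
  apply hu
  simp [axialCoord, planeEmb]

lemma IsAxial.eq_planeEmb {u : Space → ℂ} (hu : IsAxial u) (x : Space) :
    u x = u (planeEmb (axialCoord x)) :=
  hu _ _ (axialCoord_planeEmb (Real.sqrt_nonneg _)).symm

lemma IsAxial.cylMap {u : Space → ℂ} (hu : IsAxial u) {p : Plane} (hp : 0 < p 0) (θ : ℝ) :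
    u (cylMap (p, θ)) = u (planeEmb p) := by
  apply hu
  rw [axialCoord_cylMap hp, axialCoord_planeEmb hp.le]

/-- The `L²(ℝ³)` norm of an axially symmetric continuous function. -/
lemma IsAxial.lintegral_sq {u : Space → ℂ} (hu : IsAxial u) (hc : Continuous u) :
    ∫⁻ x, ‖u x‖ₑ ^ 2 = ENNReal.ofReal (2 * Real.pi) * ∫⁻ p, ‖u (planeEmb p)‖ₑ ^ 2 ∂cylMeasure := by
  have hm : Measurable fun p => ‖u (planeEmb p)‖ₑ ^ 2 :=
    (hc.comp continuous_planeEmb).measurable.enorm.pow_const 2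
  rw [← lintegral_axialCoord hm.aemeasurable]
  exact lintegral_congr fun x => by rw [← hu.eq_planeEmb]

/-! ### The arcsine measure and the inversion of circular averages -/

/-- An elementary integral that inverts the Abel transform. -/
lemma lintegral_abel_kernel {a b : ℝ} (ha : 0 < a) (hab : a < b) (hb : b < 1) :
    ∫⁻ x in Set.Ioo a b, ENNReal.ofReal
      (x / (Real.sqrt (x ^ 2 - a ^ 2) * Real.sqrt (b ^ 2 - x ^ 2) * (1 - x ^ 2))) =
    ENNReal.ofReal (Real.pi / (2 * Real.sqrt (1 - a ^ 2) * Real.sqrt (1 - b ^ 2))) := by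
  have hb0 : 0 < b := ha.trans hab
  have h1b : 0 < 1 - b ^ 2 := by nlinarith
  have h1a : 0 < 1 - a ^ 2 := by nlinarith
  have hba : 0 < b ^ 2 - a ^ 2 := by nlinarith
  let w : ℝ → ℝ := fun x => (x ^ 2 - a ^ 2) * (1 - b ^ 2) / ((b ^ 2 - a ^ 2) * (1 - x ^ 2))
  -- The primitive vanishes at `a` and is `π / 2` (up to the normalization) at `b`.
  let g : ℝ → ℝ := fun x =>
    Real.arcsin (Real.sqrt (w x)) / (Real.sqrt (1 - a ^ 2) * Real.sqrt (1 - b ^ 2))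
  have hsa : 0 < Real.sqrt (1 - a ^ 2) := Real.sqrt_pos.2 h1a
  have hsb : 0 < Real.sqrt (1 - b ^ 2) := Real.sqrt_pos.2 h1b
  have hcont : ContinuousOn g (Set.Icc a b) := by
    have hw : ContinuousOn w (Set.Icc a b) := by
      refine ContinuousOn.div (by fun_prop) (by fun_prop) fun x hx => ?_
      have : 0 < 1 - x ^ 2 := by nlinarith [hx.1, hx.2]
      positivity
    exact (Real.continuous_arcsin.comp_continuousOn hw.sqrt).div_const _
  have hderiv : ∀ x ∈ Set.Ioo a b, HasDerivAt g
      (x / (Real.sqrt (x ^ 2 - a ^ 2) * Real.sqrt (b ^ 2 - x ^ 2) * (1 - x ^ 2))) x := by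
    intro x hx
    have hx0 : 0 < x := ha.trans hx.1
    have h1 : 0 < x ^ 2 - a ^ 2 := by nlinarith [hx.1]
    have h2 : 0 < b ^ 2 - x ^ 2 := by nlinarith [hx.2]
    have h3 : 0 < 1 - x ^ 2 := by linarith
    have hwpos : 0 < w x := by positivity
    have hw1 : 1 - w x = (b ^ 2 - x ^ 2) * (1 - a ^ 2) / ((b ^ 2 - a ^ 2) * (1 - x ^ 2)) := by
      simp only [w]
      field_simp
      ring
    have hw1pos : 0 < 1 - w x := by rw [hw1]; positivity
    have hw' : HasDerivAt w ((1 - b ^ 2) * (2 * x * (1 - a ^ 2)) /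
        ((b ^ 2 - a ^ 2) * (1 - x ^ 2) ^ 2)) x := by
      have n : HasDerivAt (fun x : ℝ => (x ^ 2 - a ^ 2) * (1 - b ^ 2)) (2 * x * (1 - b ^ 2)) x := by
        simpa using (((hasDerivAt_id x).pow 2).sub_const (a ^ 2)).mul_const (1 - b ^ 2)
      have d : HasDerivAt (fun x : ℝ => (b ^ 2 - a ^ 2) * (1 - x ^ 2))
          ((b ^ 2 - a ^ 2) * (-(2 * x))) x := by
        simpa using (((hasDerivAt_id x).pow 2).const_sub 1).const_mul (b ^ 2 - a ^ 2)
      refine (n.div d (by positivity)).congr_deriv ?_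
      field_simp
      ring
    have hsq : HasDerivAt (fun x => Real.sqrt (w x)) _ x := hw'.sqrt hwpos.ne'
    have hlt : Real.sqrt (w x) < 1 := by
      rw [Real.sqrt_lt' one_pos]; linarith
    have hgt : -1 < Real.sqrt (w x) := by linarith [Real.sqrt_nonneg (w x)]
    have hg := ((Real.hasDerivAt_arcsin hgt.ne' hlt.ne).comp x hsq).div_const
      (Real.sqrt (1 - a ^ 2) * Real.sqrt (1 - b ^ 2))
    refine HasDerivAt.congr_deriv (f := g) hg ?_
    have e1 : Real.sqrt (w x) = Real.sqrt (x ^ 2 - a ^ 2) * Real.sqrt (1 - b ^ 2) /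
        (Real.sqrt (b ^ 2 - a ^ 2) * Real.sqrt (1 - x ^ 2)) := by
      simp only [w]
      rw [Real.sqrt_div (by positivity), Real.sqrt_mul h1.le, Real.sqrt_mul hba.le]
    have e2 : Real.sqrt (1 - w x) = Real.sqrt (b ^ 2 - x ^ 2) * Real.sqrt (1 - a ^ 2) /
        (Real.sqrt (b ^ 2 - a ^ 2) * Real.sqrt (1 - x ^ 2)) := by
      rw [hw1, Real.sqrt_div (by positivity), Real.sqrt_mul h2.le, Real.sqrt_mul hba.le]
    rw [Real.sq_sqrt hwpos.le, e1, e2]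
    have p1 : 0 < Real.sqrt (x ^ 2 - a ^ 2) := Real.sqrt_pos.2 h1
    have p2 : 0 < Real.sqrt (b ^ 2 - x ^ 2) := Real.sqrt_pos.2 h2
    have p3 : 0 < Real.sqrt (1 - x ^ 2) := Real.sqrt_pos.2 h3
    have p4 : 0 < Real.sqrt (b ^ 2 - a ^ 2) := Real.sqrt_pos.2 hba
    rw [← Real.sq_sqrt h1a.le, ← Real.sq_sqrt h1b.le, ← Real.sq_sqrt h3.le, ← Real.sq_sqrt hba.le]
    simp only [Real.sqrt_sq hsa.le, Real.sqrt_sq hsb.le, Real.sqrt_sq p3.le, Real.sqrt_sq p4.le]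
    field_simp
  have hnn : ∀ x ∈ Set.Ioo a b,
      0 ≤ x / (Real.sqrt (x ^ 2 - a ^ 2) * Real.sqrt (b ^ 2 - x ^ 2) * (1 - x ^ 2)) := by
    intro x hx
    have hx0 : 0 < x := ha.trans hx.1
    have h3 : 0 < 1 - x ^ 2 := by nlinarith [hx.2]
    positivity
  have hint := intervalIntegral.integrableOn_deriv_of_nonneg hcont hderiv hnn
  have hval := intervalIntegral.integral_eq_sub_of_hasDerivAt_of_le hab.le hcont hderiv
    ((intervalIntegrable_iff_integrableOn_Ioc_of_le hab.le).2 hint)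
  have hga : g a = 0 := by simp [g, w]
  have hgb : g b = Real.pi / (2 * Real.sqrt (1 - a ^ 2) * Real.sqrt (1 - b ^ 2)) := by
    have : w b = 1 := by simp only [w]; field_simp
    simp only [g, this, Real.sqrt_one, Real.arcsin_one]
    field_simp
  rw [← ofReal_integral_eq_lintegral_ofReal (hint.mono_set Set.Ioo_subset_Ioc_self)
    ((ae_restrict_iff' measurableSet_Ioo).2 (.of_forall hnn)), ← integral_Ioc_eq_integral_Ioo,
    ← intervalIntegral.integral_of_le hab.le, hval, hga, hgb, sub_zero]

/-- The image of `dθ` on `(-π, π)` under `cos`. -/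
def arcsineMeasure : Measure ℝ :=
  (volume.restrict (Set.Ioo (-1) 1)).withDensity fun c => ENNReal.ofReal (2 / Real.sqrt (1 - c ^ 2))

lemma lintegral_arcsineMeasure (F : ℝ → ℝ≥0∞) (hF : Measurable F) :
    ∫⁻ c, F c ∂arcsineMeasure =
      ∫⁻ c in Set.Ioo (-1) 1, ENNReal.ofReal (2 / Real.sqrt (1 - c ^ 2)) * F c := by
  rw [arcsineMeasure, lintegral_withDensity_eq_lintegral_mul _ (by fun_prop) hF]
  rfl

lemma cos_image_Ioo : Real.cos '' Set.Ioo 0 Real.pi = Set.Ioo (-1) 1 := by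
  ext c
  constructor
  · rintro ⟨θ, hθ, rfl⟩
    exact ⟨by simpa using Real.strictAntiOn_cos ⟨hθ.1.le, hθ.2.le⟩ ⟨Real.pi_pos.le, le_rfl⟩ hθ.2,
      by simpa using Real.strictAntiOn_cos ⟨le_rfl, Real.pi_pos.le⟩ ⟨hθ.1.le, hθ.2.le⟩ hθ.1⟩
  · intro hc
    refine ⟨Real.arccos c, ⟨Real.arccos_pos.2 hc.2, ?_⟩, Real.cos_arccos hc.1.le hc.2.le⟩
    refine lt_of_le_of_ne (Real.arccos_le_pi c) fun h => ?_
    rw [Real.arccos_eq_pi] at h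
    exact absurd hc.1 (not_lt.2 h)

lemma lintegral_cos_Ioo (F : ℝ → ℝ≥0∞) :
    ∫⁻ c in Set.Ioo (-1) 1, ENNReal.ofReal (1 / Real.sqrt (1 - c ^ 2)) * F c =
      ∫⁻ θ in Set.Ioo 0 Real.pi, F (Real.cos θ) := by
  rw [← cos_image_Ioo, lintegral_image_eq_lintegral_abs_deriv_mul measurableSet_Ioo
    (fun θ _ => (Real.hasDerivAt_cos θ).hasDerivWithinAt)
    (Real.injOn_cos.mono Set.Ioo_subset_Icc_self)]
  refine setLIntegral_congr_fun measurableSet_Ioo fun θ hθ => ?_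
  have hs : 0 < Real.sin θ := Real.sin_pos_of_pos_of_lt_pi hθ.1 hθ.2
  have e : 1 - Real.cos θ ^ 2 = Real.sin θ ^ 2 := by linarith [Real.sin_sq_add_cos_sq θ]
  simp only [e]
  rw [Real.sqrt_sq hs.le, abs_neg, abs_of_pos hs, ← mul_assoc, ← ENNReal.ofReal_mul hs.le]
  simp [hs.ne']

lemma measurePreserving_cos : MeasurePreserving Real.cos angleMeasure arcsineMeasure := by
  refine ⟨Real.measurable_cos, Measure.ext_of_lintegral _ fun F hF => ?_⟩
  have hG : Measurable fun θ => F (Real.cos θ) := hF.comp Real.measurable_cos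
  have hsplit : Set.Ioo (-Real.pi) Real.pi =ᵐ[volume]
      (Set.Ioo (-Real.pi) 0 ∪ Set.Ioo 0 Real.pi : Set ℝ) := by
    have : (Set.Ioo (-Real.pi) 0 ∪ Set.Ioo 0 Real.pi : Set ℝ) = Set.Ioo (-Real.pi) Real.pi \ {0} := by
      ext θ
      simp only [Set.mem_union, Set.mem_Ioo, Set.mem_sdiff, Set.mem_singleton_iff]
      have := Real.pi_pos
      constructor
      · rintro (h | h)
        · exact ⟨⟨h.1, by linarith⟩, h.2.ne⟩
        · exact ⟨⟨by linarith, h.2⟩, h.1.ne'⟩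
      · rintro ⟨h, h0⟩
        rcases lt_or_gt_of_ne h0 with h1 | h1
        · exact .inl ⟨h.1, h1⟩
        · exact .inr ⟨h1, h.2⟩
    rw [this]
    exact (sdiff_null_ae_eq_self (measure_singleton (0 : ℝ))).symm
  have hneg : ∫⁻ θ in Set.Ioo (-Real.pi) 0, F (Real.cos θ) =
      ∫⁻ θ in Set.Ioo 0 Real.pi, F (Real.cos θ) := by
    have h := (Measure.measurePreserving_neg (volume : Measure ℝ)).setLIntegral_comp_preimage_emb
      (MeasurableEquiv.neg ℝ).measurableEmbedding (fun θ => F (Real.cos θ)) (Set.Ioo 0 Real.pi)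
    simpa using h
  rw [lintegral_map hF Real.measurable_cos, setLIntegral_congr hsplit,
    lintegral_union measurableSet_Ioo (Set.disjoint_left.2 fun x h1 h2 => absurd h1.2 h2.1.not_gt),
    hneg, lintegral_arcsineMeasure F hF, ← two_mul, ← lintegral_cos_Ioo,
    ← lintegral_const_mul _ (by fun_prop)]
  refine lintegral_congr fun c => ?_
  rw [← mul_assoc]
  congr 1
  rw [show (2 : ℝ≥0∞) = ENNReal.ofReal 2 by simp, ← ENNReal.ofReal_mul zero_le_two]
  congr 1
  ring

instance : IsFiniteMeasure arcsineMeasure := by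
  rw [← measurePreserving_cos.map_eq]
  infer_instance

/-- Scaling of a weighted integral over an interval. -/
lemma lintegral_Ioo_scale {x : ℝ} (hx : 0 < x) (a b : ℝ) (F : ℝ → ℝ≥0∞) :
    ∫⁻ c in Set.Ioo (x * a) (x * b), F c = ∫⁻ c in Set.Ioo a b, ENNReal.ofReal x * F (x * c) := by
  have h : (fun c => x * c) '' Set.Ioo a b = Set.Ioo (x * a) (x * b) :=
    Set.image_mul_left_Ioo hx a b
  rw [← h, lintegral_image_eq_lintegral_abs_deriv_mul measurableSet_Ioo
    (f := fun c => x * c) (f' := fun _ => x)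
    (fun c _ => by simpa using ((hasDerivAt_id c).const_mul x).hasDerivWithinAt)
    ((mul_right_injective₀ hx.ne').injOn)]
  simp [abs_of_pos hx]

lemma lintegral_arcsineMeasure_scale {x : ℝ} (hx : 0 < x) (F : ℝ → ℝ≥0∞) (hF : Measurable F) :
    ∫⁻ c, F (x * c) ∂arcsineMeasure =
      ∫⁻ c in Set.Ioo (-x) x, ENNReal.ofReal (2 / Real.sqrt (x ^ 2 - c ^ 2)) * F c := by
  have h := lintegral_Ioo_scale hx (-1) 1
    (fun c => ENNReal.ofReal (2 / Real.sqrt (x ^ 2 - c ^ 2)) * F c)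
  rw [show x * -1 = -x by ring, mul_one] at h
  rw [h, lintegral_arcsineMeasure (fun c => F (x * c)) (by fun_prop)]
  refine lintegral_congr fun c => ?_
  rw [← mul_assoc, ← ENNReal.ofReal_mul hx.le]
  congr 2
  rw [show x ^ 2 - (x * c) ^ 2 = x ^ 2 * (1 - c ^ 2) by ring, Real.sqrt_mul (by positivity),
    Real.sqrt_sq hx.le]
  field_simp

/-- The weight that recovers the part `|c| < y` of the arcsine measure from dilates of the arcsine
measure by factors `x`; it is meant for `0 < x < y < 1`. -/
def abelWeight (y x : ℝ) : ℝ := x / (Real.sqrt (y ^ 2 - x ^ 2) * (1 - x ^ 2))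

lemma measurable_abelWeight (y : ℝ) : Measurable (abelWeight y) := by
  unfold abelWeight
  fun_prop

/-- The measure on `(0, y)` with density `abelWeight y`. -/
def abelMeasure (y : ℝ) : Measure ℝ :=
  (volume.restrict (Set.Ioo 0 y)).withDensity fun x => ENNReal.ofReal (abelWeight y x)

lemma lintegral_abelMeasure (y : ℝ) (F : ℝ → ℝ≥0∞) (hF : Measurable F) :
    ∫⁻ x, F x ∂abelMeasure y =
      ∫⁻ x in Set.Ioo 0 y, ENNReal.ofReal (abelWeight y x) * F x := by
  rw [abelMeasure, lintegral_withDensity_eq_lintegral_mul _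
    (measurable_abelWeight y).ennreal_ofReal hF]
  rfl

instance (y : ℝ) : SFinite (abelMeasure y) := by unfold abelMeasure; infer_instance

/-- Abel inversion: the arcsine measure on `(-y, y)` is an average of dilates of the full arcsine
measure. -/
lemma lintegral_abelMeasure_arcsineMeasure {y : ℝ} (hy0 : 0 < y) (hy1 : y < 1) (F : ℝ → ℝ≥0∞)
    (hF : Measurable F) :
    ∫⁻ x, ∫⁻ c, F (x * c) ∂arcsineMeasure ∂abelMeasure y =
      ENNReal.ofReal (Real.pi / (2 * Real.sqrt (1 - y ^ 2))) *
        ∫⁻ c in Set.Ioo (-y) y, F c ∂arcsineMeasure := by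
  have h1y : 0 < 1 - y ^ 2 := by nlinarith
  have hm : Measurable fun x => ∫⁻ c, F (x * c) ∂arcsineMeasure :=
    (hF.comp (by fun_prop : Measurable fun q : ℝ × ℝ => q.1 * q.2)).lintegral_prod_right'
  let T : Set (ℝ × ℝ) := {q | |q.2| < q.1 ∧ q.1 < y}
  have hT : MeasurableSet T :=
    (measurableSet_lt (measurable_norm.comp measurable_snd) measurable_fst).inter
      (measurableSet_lt measurable_fst measurable_const)
  let J : ℝ × ℝ → ℝ≥0∞ := T.indicator fun q => ENNReal.ofReal (abelWeight y q.1) *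
    (ENNReal.ofReal (2 / Real.sqrt (q.1 ^ 2 - q.2 ^ 2)) * F q.2)
  have hJ : Measurable J := by
    refine Measurable.indicator ?_ hT
    exact ((measurable_abelWeight y).comp measurable_fst).ennreal_ofReal.mul
      ((by fun_prop : Measurable fun q : ℝ × ℝ =>
        ENNReal.ofReal (2 / Real.sqrt (q.1 ^ 2 - q.2 ^ 2))).mul (hF.comp measurable_snd))
  have e1 : ∫⁻ x, ∫⁻ c, F (x * c) ∂arcsineMeasure ∂abelMeasure y = ∫⁻ x, ∫⁻ c, J (x, c) := by
    rw [lintegral_abelMeasure y _ hm, ← lintegral_indicator measurableSet_Ioo]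
    refine lintegral_congr fun x => ?_
    by_cases hx : x ∈ Set.Ioo 0 y
    · rw [Set.indicator_of_mem hx, lintegral_arcsineMeasure_scale hx.1 F hF,
        ← lintegral_const_mul _ (by fun_prop), ← lintegral_indicator measurableSet_Ioo]
      refine lintegral_congr fun c => ?_
      have : (x, c) ∈ T ↔ c ∈ Set.Ioo (-x) x := by
        simp [T, abs_lt, hx.2]
      by_cases hc : c ∈ Set.Ioo (-x) x
      · rw [Set.indicator_of_mem hc]
        simp only [J, Set.indicator_of_mem (this.2 hc)]
      · rw [Set.indicator_of_notMem hc]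
        simp only [J, Set.indicator_of_notMem (fun h => hc (this.1 h))]
    · rw [Set.indicator_of_notMem hx]
      symm
      refine (lintegral_congr fun c => ?_).trans lintegral_zero
      refine Set.indicator_of_notMem (fun h => hx ⟨(abs_nonneg c).trans_lt h.1, h.2⟩) _
  have e2 : ENNReal.ofReal (Real.pi / (2 * Real.sqrt (1 - y ^ 2))) *
        ∫⁻ c in Set.Ioo (-y) y, F c ∂arcsineMeasure = ∫⁻ c, ∫⁻ x, J (x, c) := by
    rw [← lintegral_indicator measurableSet_Ioo, lintegral_arcsineMeasure _
      (hF.indicator measurableSet_Ioo), ← lintegral_indicator measurableSet_Ioo,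
      ← lintegral_const_mul _ (by
        refine Measurable.indicator (Measurable.mul ?_ (hF.indicator measurableSet_Ioo))
          measurableSet_Ioo
        fun_prop)]
    refine lintegral_congr_ae ?_
    filter_upwards [Measure.ae_ne volume (0 : ℝ)] with c hc0
    by_cases hc : c ∈ Set.Ioo (-y) y
    · have hcy : |c| < y := abs_lt.2 hc
      have hc1 : c ∈ Set.Ioo (-1 : ℝ) 1 := ⟨by linarith [hc.1], by linarith [hc.2]⟩
      rw [Set.indicator_of_mem hc1, Set.indicator_of_mem hc]
      have hk := lintegral_abel_kernel (abs_pos.2 hc0) hcy hy1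
      have : ∫⁻ x, J (x, c) = 2 * F c * ∫⁻ x in Set.Ioo |c| y, ENNReal.ofReal
          (x / (Real.sqrt (x ^ 2 - |c| ^ 2) * Real.sqrt (y ^ 2 - x ^ 2) * (1 - x ^ 2))) := by
        rw [← lintegral_const_mul _ (by fun_prop), ← lintegral_indicator measurableSet_Ioo]
        refine lintegral_congr fun x => ?_
        by_cases hx : x ∈ Set.Ioo |c| y
        · have hx' : (x, c) ∈ T := hx
          have hx0 : 0 < x := (abs_nonneg c).trans_lt hx.1
          have h1x : 0 < 1 - x ^ 2 := by nlinarith [hx.2]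
          rw [Set.indicator_of_mem hx]
          simp only [J, Set.indicator_of_mem hx', sq_abs, abelWeight]
          rw [← mul_assoc, ← ENNReal.ofReal_mul (by positivity), mul_assoc, mul_comm (F c),
            ← mul_assoc, show (2 : ℝ≥0∞) = ENNReal.ofReal 2 by simp,
            ← ENNReal.ofReal_mul (by positivity)]
          congr 2
          rw [div_mul_div_comm, mul_div_assoc']
          congr 1
          · ring
          · ring
        · have hx' : (x, c) ∉ T := hx
          rw [Set.indicator_of_notMem hx]
          simp only [J, Set.indicator_of_notMem hx']
      rw [this, hk, sq_abs, ← mul_assoc, ← ENNReal.ofReal_mul (by positivity),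
        show (2 : ℝ≥0∞) = ENNReal.ofReal 2 by simp, mul_assoc, mul_comm (F c), ← mul_assoc,
        ← ENNReal.ofReal_mul (by positivity)]
      congr 2
      ring
    · have : ∀ x, J (x, c) = 0 := fun x =>
        Set.indicator_of_notMem (fun h => hc (abs_lt.1 (h.1.trans h.2))) _
      simp [this, Set.indicator_of_notMem hc]
  rw [e1, e2, lintegral_lintegral_swap (f := fun x c => J (x, c)) hJ.aemeasurable]

/-- The integral of a bounded function over the part `|c| < y` of the arcsine measure is controlled
by its averages over dilates of the full arcsine measure. -/
lemma enorm_setIntegral_arcsineMeasure_le {y : ℝ} (hy0 : 0 < y) (hy1 : y < 1) {Q : ℝ → ℂ}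
    (hQ : Continuous Q) {B : ℝ} (hB : ∀ c, ‖Q c‖ ≤ B) :
    ‖∫ c in Set.Ioo (-y) y, Q c ∂arcsineMeasure‖ₑ ≤
      ENNReal.ofReal (2 * Real.sqrt (1 - y ^ 2) / Real.pi) *
        ∫⁻ x, ‖∫ c, Q (x * c) ∂arcsineMeasure‖ₑ ∂abelMeasure y := by
  have h1y : 0 < 1 - y ^ 2 := by nlinarith
  have hs : 0 < Real.sqrt (1 - y ^ 2) := Real.sqrt_pos.2 h1y
  have hmul : Measurable fun q : ℝ × ℝ => q.1 * q.2 := by fun_prop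
  set C := Real.pi / (2 * Real.sqrt (1 - y ^ 2)) with hC
  have hCpos : 0 < C := by have := Real.pi_pos; positivity
  have hmp : MeasurePreserving (fun q : ℝ × ℝ => q.1 * q.2)
      ((abelMeasure y).prod arcsineMeasure)
      (ENNReal.ofReal C • arcsineMeasure.restrict (Set.Ioo (-y) y)) := by
    refine ⟨hmul, Measure.ext_of_lintegral _ fun F hF => ?_⟩
    rw [lintegral_map hF hmul, lintegral_prod (fun q : ℝ × ℝ => F (q.1 * q.2))
      (hF.comp hmul).aemeasurable, lintegral_abelMeasure_arcsineMeasure hy0 hy1 F hF,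
      lintegral_smul_measure, smul_eq_mul]
  have hfin : IsFiniteMeasure ((abelMeasure y).prod arcsineMeasure) := by
    refine ⟨?_⟩
    have := hmp.measure_preimage (s := Set.univ) MeasurableSet.univ.nullMeasurableSet
    rw [Set.preimage_univ] at this
    rw [this, Measure.smul_apply, smul_eq_mul]
    exact ENNReal.mul_lt_top ENNReal.ofReal_lt_top (measure_lt_top _ _)
  have hint : Integrable (fun q : ℝ × ℝ => Q (q.1 * q.2))
      ((abelMeasure y).prod arcsineMeasure) :=
    Integrable.of_bound (hQ.comp (by fun_prop)).aestronglyMeasurable B (.of_forall fun _ => hB _)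
  have key : C • ∫ c in Set.Ioo (-y) y, Q c ∂arcsineMeasure =
      ∫ x, ∫ c, Q (x * c) ∂arcsineMeasure ∂abelMeasure y := by
    rw [← integral_prod _ hint, ← ENNReal.toReal_ofReal hCpos.le, ← integral_smul_measure,
      ← hmp.map_eq, integral_map hmul.aemeasurable hQ.aestronglyMeasurable]
  have e : ∫ c in Set.Ioo (-y) y, Q c ∂arcsineMeasure =
      (2 * Real.sqrt (1 - y ^ 2) / Real.pi) •
        ∫ x, ∫ c, Q (x * c) ∂arcsineMeasure ∂abelMeasure y := by
    rw [← key, smul_smul, hC]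
    have := Real.pi_pos
    field_simp
    simp
  rw [e, enorm_smul, Real.enorm_of_nonneg (by have := Real.pi_pos; positivity)]
  gcongr
  exact enorm_integral_le_lintegral_enorm _

/-! ### Averages over dilations -/

/-- The average of the dilates of `h` with weight `w`. -/
def dilAvg (w h : ℝ → ℝ≥0∞) (k : ℝ) : ℝ≥0∞ := ∫⁻ y in Set.Ioo 0 1, w y * h (k * y)

lemma measurable_dilAvg {w h : ℝ → ℝ≥0∞} (hw : Measurable w) (hh : Measurable h) :
    Measurable (dilAvg w h) :=
  Measurable.lintegral_prod_right' (f := fun q : ℝ × ℝ => w q.2 * h (q.1 * q.2))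
    ((hw.comp measurable_snd).mul (hh.comp (by fun_prop)))

lemma lintegral_mul_sq_le {α : Type*} [MeasurableSpace α] {μ : Measure α} {f g : α → ℝ≥0∞}
    (hf : AEMeasurable f μ) (hg : AEMeasurable g μ) :
    (∫⁻ a, f a * g a ∂μ) ^ 2 ≤ (∫⁻ a, f a ^ 2 ∂μ) * ∫⁻ a, g a ^ 2 ∂μ := by
  have h := ENNReal.lintegral_mul_le_Lp_mul_Lq μ Real.HolderConjugate.two_two hf hg
  calc _ ≤ ((∫⁻ a, f a ^ (2 : ℝ) ∂μ) ^ (1 / (2 : ℝ)) * (∫⁻ a, g a ^ (2 : ℝ) ∂μ) ^ (1 / (2 : ℝ))) ^ 2 :=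
        pow_le_pow_left' h 2
    _ = _ := by
      rw [mul_pow, ← ENNReal.rpow_natCast, ← ENNReal.rpow_natCast, ← ENNReal.rpow_mul,
        ← ENNReal.rpow_mul]
      norm_num

/-- Schur's test for averages over dilations, on `L²(k dk)`: as a dilation by `y` multiplies the
norm by `1 / y`, the operator norm is at most `∫ w(y) dy / y`. -/
lemma lintegral_dilAvg_sq_le {w h : ℝ → ℝ≥0∞} (hw : Measurable w) (hh : Measurable h) :
    ∫⁻ k in Set.Ioi 0, ENNReal.ofReal k * dilAvg w h k ^ 2 ≤
      (∫⁻ y in Set.Ioo 0 1, w y * ENNReal.ofReal y⁻¹) ^ 2 *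
        ∫⁻ k in Set.Ioi 0, ENNReal.ofReal k * h k ^ 2 := by
  set W := ∫⁻ y in Set.Ioo 0 1, w y * ENNReal.ofReal y⁻¹ with hW
  have hcs : ∀ k, dilAvg w h k ^ 2 ≤
      W * ∫⁻ y in Set.Ioo 0 1, w y * ENNReal.ofReal y * h (k * y) ^ 2 := by
    intro k
    have h1 := lintegral_mul_sq_le (μ := volume.restrict (Set.Ioo (0 : ℝ) 1))
      (f := fun y => (w y * ENNReal.ofReal y⁻¹) ^ (1 / 2 : ℝ))
      (g := fun y => (w y * ENNReal.ofReal y) ^ (1 / 2 : ℝ) * h (k * y))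
      (by fun_prop) (by fun_prop)
    have sq : ∀ a : ℝ≥0∞, (a ^ (1 / 2 : ℝ)) ^ 2 = a := fun a => by
      rw [← ENNReal.rpow_natCast, ← ENNReal.rpow_mul]
      norm_num
    refine le_trans (le_of_eq ?_) (h1.trans (le_of_eq ?_))
    · rw [dilAvg]
      congr 1
      refine setLIntegral_congr_fun measurableSet_Ioo fun y hy => ?_
      have hy0 : 0 < y := hy.1
      rw [← mul_assoc, ← ENNReal.mul_rpow_of_nonneg _ _ (by norm_num)]
      have : w y * ENNReal.ofReal y⁻¹ * (w y * ENNReal.ofReal y) = w y ^ 2 := by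
        have : ENNReal.ofReal y⁻¹ * ENNReal.ofReal y = 1 := by
          rw [← ENNReal.ofReal_mul (by positivity), inv_mul_cancel₀ hy0.ne', ENNReal.ofReal_one]
        calc _ = w y ^ 2 * (ENNReal.ofReal y⁻¹ * ENNReal.ofReal y) := by ring
          _ = _ := by rw [this, mul_one]
      rw [this, ← ENNReal.rpow_natCast, ← ENNReal.rpow_mul]
      norm_num
    · simp only [mul_pow, sq, hW]
  calc ∫⁻ k in Set.Ioi 0, ENNReal.ofReal k * dilAvg w h k ^ 2
      ≤ ∫⁻ k in Set.Ioi 0, W * ∫⁻ y in Set.Ioo 0 1,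
          ENNReal.ofReal k * (w y * ENNReal.ofReal y * h (k * y) ^ 2) := by
        refine lintegral_mono fun k => ?_
        simp only
        rw [lintegral_const_mul _ (by fun_prop)]
        calc _ ≤ ENNReal.ofReal k * (W * ∫⁻ y in Set.Ioo 0 1,
              w y * ENNReal.ofReal y * h (k * y) ^ 2) := by gcongr; exact hcs k
          _ = _ := by ring
    _ = W * ∫⁻ y in Set.Ioo 0 1, ∫⁻ k in Set.Ioi 0,
          ENNReal.ofReal k * (w y * ENNReal.ofReal y * h (k * y) ^ 2) := by
        rw [lintegral_const_mul _ (by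
          refine Measurable.lintegral_prod_right' (f := fun q : ℝ × ℝ =>
            ENNReal.ofReal q.1 * (w q.2 * ENNReal.ofReal q.2 * h (q.1 * q.2) ^ 2)) ?_
          fun_prop), lintegral_lintegral_swap (by fun_prop)]
    _ = W * ∫⁻ y in Set.Ioo 0 1, w y * ENNReal.ofReal y⁻¹ *
          ∫⁻ k in Set.Ioi 0, ENNReal.ofReal k * h k ^ 2 := by
        congr 1
        refine setLIntegral_congr_fun measurableSet_Ioo fun y hy => ?_
        have hy0 : 0 < y := hy.1
        have himg : (fun k => y * k) '' Set.Ioi 0 = Set.Ioi (0 : ℝ) := by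
          rw [Set.image_mul_left_Ioi hy0, mul_zero]
        have hsc : ∫⁻ k in Set.Ioi 0, ENNReal.ofReal k * h k ^ 2 =
            ∫⁻ k in Set.Ioi 0, ENNReal.ofReal y * (ENNReal.ofReal (y * k) * h (y * k) ^ 2) := by
          conv_lhs => rw [← himg]
          rw [lintegral_image_eq_lintegral_abs_deriv_mul measurableSet_Ioi
            (f := fun c => y * c) (f' := fun _ => y)
            (fun c _ => by simpa using ((hasDerivAt_id c).const_mul y).hasDerivWithinAt)
            ((mul_right_injective₀ hy0.ne').injOn), abs_of_pos hy0]
        rw [hsc, ← lintegral_const_mul _ (by fun_prop)]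
        refine setLIntegral_congr_fun measurableSet_Ioi fun k hk => ?_
        have hy1 : ENNReal.ofReal y⁻¹ * ENNReal.ofReal y = 1 := by
          rw [← ENNReal.ofReal_mul (by positivity), inv_mul_cancel₀ hy0.ne', ENNReal.ofReal_one]
        rw [ENNReal.ofReal_mul hy0.le, mul_comm k y]
        calc _ = w y * 1 * ENNReal.ofReal y * ENNReal.ofReal k * h (y * k) ^ 2 := by ring
          _ = _ := by rw [← hy1]; ring
    _ = _ := by
        rw [lintegral_mul_const _ (by fun_prop), ← mul_assoc, sq]

lemma lintegral_inv_sqrt_lt_top :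
    ∫⁻ x in Set.Ioo (0 : ℝ) 1, ENNReal.ofReal (1 / Real.sqrt (1 - x ^ 2)) < ⊤ := by
  have h := lintegral_arcsineMeasure (fun _ => 1) measurable_const
  rw [lintegral_const, one_mul] at h
  refine lt_of_le_of_lt ?_ (measure_lt_top arcsineMeasure Set.univ)
  rw [h]
  calc _ ≤ ∫⁻ x in Set.Ioo (-1 : ℝ) 1, ENNReal.ofReal (1 / Real.sqrt (1 - x ^ 2)) :=
        lintegral_mono_set (Set.Ioo_subset_Ioo_left (by norm_num))
    _ ≤ _ := by
        refine lintegral_mono fun x => ?_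
        simp only [mul_one]
        gcongr
        norm_num

lemma lintegral_rpow_div_sqrt_lt_top {s : ℝ} (hs : 0 < s) :
    ∫⁻ y in Set.Ioo (0 : ℝ) 1, ENNReal.ofReal (y ^ (s - 1) / Real.sqrt (1 - y ^ 2)) < ⊤ := by
  have hpow : ∫⁻ y in Set.Ioo (0 : ℝ) 1, ENNReal.ofReal (y ^ (s - 1)) < ⊤ := by
    have h1 : IntegrableOn (fun y : ℝ => y ^ (s - 1)) (Set.Ioo 0 1) :=
      (intervalIntegral.integrableOn_Ioo_rpow_iff one_pos).2 (by linarith)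
    exact h1.lintegral_lt_top
  calc _ ≤ ∫⁻ y in Set.Ioo (0 : ℝ) 1, (2 * ENNReal.ofReal (y ^ (s - 1)) +
        2 * ENNReal.ofReal (1 / Real.sqrt (1 - y ^ 2))) := by
        refine setLIntegral_mono (by fun_prop) fun y hy => ?_
        have hy0 : 0 < y := hy.1
        have h1 : 0 < 1 - y ^ 2 := by nlinarith [hy.1, hy.2]
        have hsq : 0 < Real.sqrt (1 - y ^ 2) := Real.sqrt_pos.2 h1
        have hyp : 0 < y ^ (s - 1) := Real.rpow_pos_of_pos hy0 _
        rw [show (2 : ℝ≥0∞) = ENNReal.ofReal 2 by simp, ← ENNReal.ofReal_mul zero_le_two,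
          ← ENNReal.ofReal_mul zero_le_two, ← ENNReal.ofReal_add (by positivity) (by positivity)]
        refine ENNReal.ofReal_le_ofReal ?_
        rcases le_total y (1 / 2) with h | h
        · have h2 : 1 / 2 ≤ Real.sqrt (1 - y ^ 2) := Real.le_sqrt_of_sq_le (by nlinarith)
          have h3 : y ^ (s - 1) / Real.sqrt (1 - y ^ 2) ≤ 2 * y ^ (s - 1) := by
            rw [div_le_iff₀ hsq]; nlinarith
          have : 0 ≤ 2 * (1 / Real.sqrt (1 - y ^ 2)) := by positivity
          linarith
        · have h2 : y ^ (s - 1) ≤ 2 := by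
            calc y ^ (s - 1) ≤ y ^ (-1 : ℝ) :=
                  Real.rpow_le_rpow_of_exponent_ge hy0 hy.2.le (by linarith)
              _ = y⁻¹ := Real.rpow_neg_one y
              _ ≤ (1 / 2)⁻¹ := by gcongr
              _ = 2 := by norm_num
          have h3 : y ^ (s - 1) / Real.sqrt (1 - y ^ 2) ≤ 2 * (1 / Real.sqrt (1 - y ^ 2)) := by
            rw [mul_one_div]; gcongr
          linarith
    _ < ⊤ := by
        rw [lintegral_add_left (by fun_prop), lintegral_const_mul _ (by fun_prop),
          lintegral_const_mul _ (by fun_prop)]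
        exact ENNReal.add_lt_top.2 ⟨ENNReal.mul_lt_top (by simp) hpow,
          ENNReal.mul_lt_top (by simp) lintegral_inv_sqrt_lt_top⟩

/-! ### The fractional multiplier under circular averages -/

/-- The quotient `(k² c² + q)^{s/2} / (k² + q)^{s/2}` of the two symbols. -/
def symbolRatio (s q k c : ℝ) : ℝ := ((k ^ 2 * c ^ 2 + q) / (k ^ 2 + q)) ^ (s / 2)

/-- The derivative of `c ↦ symbolRatio s q k c`. -/
def symbolRatioDeriv (s q k y : ℝ) : ℝ :=
  2 * k ^ 2 * y / (k ^ 2 + q) * (s / 2) * ((k ^ 2 * y ^ 2 + q) / (k ^ 2 + q)) ^ (s / 2 - 1)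

lemma measurable_symbolRatioDeriv (s q k : ℝ) : Measurable (symbolRatioDeriv s q k) := by
  unfold symbolRatioDeriv
  fun_prop

section

variable {s q k : ℝ}

lemma hasDerivAt_symbolRatio (hq : 0 ≤ q) (hk : 0 < k) {y : ℝ} (hy : 0 < y) :
    HasDerivAt (symbolRatio s q k) (symbolRatioDeriv s q k y) y := by
  have h : HasDerivAt (fun c : ℝ => (k ^ 2 * c ^ 2 + q) / (k ^ 2 + q))
      (2 * k ^ 2 * y / (k ^ 2 + q)) y := by
    have := ((((hasDerivAt_id y).pow 2).const_mul (k ^ 2)).add_const q).div_const (k ^ 2 + q)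
    refine this.congr_deriv ?_
    simp
    ring
  exact h.rpow_const (.inl (by positivity))

lemma symbolRatioDeriv_nonneg (hs : 0 ≤ s) (hq : 0 ≤ q) {y : ℝ} (hy : 0 ≤ y) :
    0 ≤ symbolRatioDeriv s q k y := by
  unfold symbolRatioDeriv; positivity

/-- This bound is uniform in `q` and `k`. It uses `s ≤ 2`: the exponent `s / 2 - 1` is nonpositive,
so the base may be replaced by its lower bound `y²`. -/
lemma symbolRatioDeriv_le (hs : 0 ≤ s) (hs2 : s ≤ 2) (hq : 0 ≤ q) (hk : 0 < k) {y : ℝ}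
    (hy : 0 < y) (hy1 : y < 1) : symbolRatioDeriv s q k y ≤ s * y ^ (s - 1) := by
  have h1 : k ^ 2 / (k ^ 2 + q) ≤ 1 := by rw [div_le_one (by positivity)]; linarith
  have h2 : y ^ 2 ≤ (k ^ 2 * y ^ 2 + q) / (k ^ 2 + q) := by
    rw [le_div_iff₀ (by positivity)]
    have : 0 ≤ q * (1 - y ^ 2) := mul_nonneg hq (by nlinarith)
    linarith
  have h3 : ((k ^ 2 * y ^ 2 + q) / (k ^ 2 + q)) ^ (s / 2 - 1) ≤ y ^ (s - 2) := by
    calc _ ≤ (y ^ 2) ^ (s / 2 - 1) :=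
          Real.rpow_le_rpow_of_nonpos (by positivity) h2 (by linarith)
      _ = y ^ (s - 2) := by
          rw [← Real.rpow_natCast, ← Real.rpow_mul hy.le]
          congr 1
          push_cast
          ring
  have h4 : y ^ (s - 1) = y * y ^ (s - 2) := by
    rw [show s - 1 = 1 + (s - 2) by ring, Real.rpow_add hy, Real.rpow_one]
  calc symbolRatioDeriv s q k y
      = s * y * (k ^ 2 / (k ^ 2 + q)) *
        ((k ^ 2 * y ^ 2 + q) / (k ^ 2 + q)) ^ (s / 2 - 1) := by
        unfold symbolRatioDeriv; ring
    _ ≤ s * y * 1 * y ^ (s - 2) := by gcongr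
    _ = s * y ^ (s - 1) := by rw [h4]; ring

lemma integrableOn_symbolRatioDeriv (hs : 0 < s) (hs2 : s ≤ 2) (hq : 0 ≤ q) (hk : 0 < k) :
    IntegrableOn (symbolRatioDeriv s q k) (Set.Ioo 0 1) := by
  have h1 : IntegrableOn (fun y : ℝ => s * y ^ (s - 1)) (Set.Ioo 0 1) :=
    ((intervalIntegral.integrableOn_Ioo_rpow_iff one_pos).2 (by linarith)).const_mul s
  refine Integrable.mono' h1 (measurable_symbolRatioDeriv s q k).aestronglyMeasurable ?_
  refine (ae_restrict_iff' measurableSet_Ioo).2 (.of_forall fun y hy => ?_)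
  rw [Real.norm_of_nonneg (symbolRatioDeriv_nonneg hs.le hq hy.1.le)]
  exact symbolRatioDeriv_le hs.le hs2 hq hk hy.1 hy.2

lemma integral_symbolRatioDeriv (hs : 0 < s) (hs2 : s ≤ 2) (hq : 0 ≤ q) (hk : 0 < k) {c : ℝ}
    (hc0 : c ≠ 0) (hc1 : |c| < 1) :
    ∫ y in Set.Ioo |c| 1, symbolRatioDeriv s q k y = 1 - symbolRatio s q k c := by
  have hcpos := abs_pos.2 hc0
  rw [← integral_Ioc_eq_integral_Ioo, ← intervalIntegral.integral_of_le hc1.le,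
    intervalIntegral.integral_eq_sub_of_hasDerivAt (f := symbolRatio s q k)]
  · simp only [symbolRatio, sq_abs]
    rw [one_pow, mul_one, div_self (by positivity), Real.one_rpow]
  · intro y hy
    rw [Set.uIcc_of_le hc1.le] at hy
    exact hasDerivAt_symbolRatio hq hk (hcpos.trans_le hy.1)
  · rw [intervalIntegrable_iff_integrableOn_Ioo_of_le hc1.le]
    exact (integrableOn_symbolRatioDeriv hs hs2 hq hk).mono_set
      (Set.Ioo_subset_Ioo_left hcpos.le)

lemma ae_arcsineMeasure : ∀ᵐ c ∂arcsineMeasure, c ≠ 0 ∧ |c| < 1 := by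
  refine (withDensity_absolutelyContinuous _ _).ae_le ?_
  filter_upwards [ae_restrict_mem measurableSet_Ioo, ae_restrict_of_ae (Measure.ae_ne volume 0)]
    with c h1 h2
  exact ⟨h2, abs_lt.2 h1⟩

/-- Integration by parts in the variable `|c|`: the quotient is written as `1 - ∫_{|c|}^1` of its
derivative, and the integrals are exchanged. -/
lemma enorm_integral_symbolRatio_le (hs : 0 < s) (hs2 : s ≤ 2) (hq : 0 ≤ q) (hk : 0 < k)
    {Q : ℝ → ℂ} (hQ : Continuous Q) {B : ℝ} (hB : ∀ c, ‖Q c‖ ≤ B) :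
    ‖∫ c, (symbolRatio s q k c : ℂ) * Q c ∂arcsineMeasure‖ₑ ≤
      ‖∫ c, Q c ∂arcsineMeasure‖ₑ + ∫⁻ y in Set.Ioo 0 1, ENNReal.ofReal (s * y ^ (s - 1)) *
        ‖∫ c in Set.Ioo (-y) y, Q c ∂arcsineMeasure‖ₑ := by
  set ρ := symbolRatioDeriv s q k with hρ
  have hQint : Integrable Q arcsineMeasure :=
    Integrable.of_bound hQ.aestronglyMeasurable B (.of_forall hB)
  let T : Set (ℝ × ℝ) := {p | |p.1| < p.2}
  have hT : MeasurableSet T :=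
    measurableSet_lt (measurable_norm.comp measurable_fst) measurable_snd
  let J : ℝ × ℝ → ℂ := T.indicator fun p => Q p.1 * (ρ p.2 : ℂ)
  have hρint : Integrable (fun y => (ρ y : ℂ)) (volume.restrict (Set.Ioo 0 1)) :=
    (integrableOn_symbolRatioDeriv hs hs2 hq hk).ofReal
  have hJ : Integrable J (arcsineMeasure.prod (volume.restrict (Set.Ioo 0 1))) :=
    (hQint.mul_prod hρint).indicator hT
  have e1 : ∀ᵐ c ∂arcsineMeasure, ∫ y in Set.Ioo 0 1, J (c, y) =
      Q c - (symbolRatio s q k c : ℂ) * Q c := by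
    filter_upwards [ae_arcsineMeasure] with c hc
    have : ∫ y in Set.Ioo 0 1, J (c, y) = ∫ y in Set.Ioo |c| 1, Q c * (ρ y : ℂ) := by
      rw [← integral_indicator measurableSet_Ioo, ← integral_indicator measurableSet_Ioo]
      congr 1
      ext y
      by_cases hy : y ∈ Set.Ioo |c| 1
      · have h1 : (c, y) ∈ T := hy.1
        have h2 : y ∈ Set.Ioo (0 : ℝ) 1 := ⟨(abs_nonneg c).trans_lt hy.1, hy.2⟩
        simp only [Set.indicator_of_mem hy, Set.indicator_of_mem h2, J, Set.indicator_of_mem h1]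
      · rw [Set.indicator_of_notMem hy]
        by_cases h2 : y ∈ Set.Ioo (0 : ℝ) 1
        · have h1 : (c, y) ∉ T := fun h => hy ⟨h, h2.2⟩
          simp only [Set.indicator_of_mem h2, J, Set.indicator_of_notMem h1]
        · rw [Set.indicator_of_notMem h2]
    rw [this, integral_const_mul, integral_complex_ofReal, hρ,
      integral_symbolRatioDeriv hs hs2 hq hk hc.1 hc.2]
    push_cast
    ring
  have e2 : ∀ y ∈ Set.Ioo (0 : ℝ) 1, ∫ c, J (c, y) ∂arcsineMeasure =
      (ρ y : ℂ) * ∫ c in Set.Ioo (-y) y, Q c ∂arcsineMeasure := by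
    intro y hy
    rw [← integral_const_mul, ← integral_indicator measurableSet_Ioo]
    congr 1
    ext c
    by_cases hc : c ∈ Set.Ioo (-y) y
    · have h1 : (c, y) ∈ T := abs_lt.2 hc
      simp only [Set.indicator_of_mem hc, J, Set.indicator_of_mem h1, mul_comm]
    · have h1 : (c, y) ∉ T := fun h => hc (abs_lt.1 h)
      simp only [Set.indicator_of_notMem hc, J, Set.indicator_of_notMem h1]
  have hrint : Integrable (fun c => (symbolRatio s q k c : ℂ) * Q c) arcsineMeasure := by
    have := hJ.integral_prod_left
    have h2 := hQint.sub this
    refine h2.congr ?_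
    filter_upwards [e1] with c hc
    simp [hc]
  have key : ∫ c, (symbolRatio s q k c : ℂ) * Q c ∂arcsineMeasure = ∫ c, Q c ∂arcsineMeasure -
      ∫ y in Set.Ioo 0 1, (ρ y : ℂ) * ∫ c in Set.Ioo (-y) y, Q c ∂arcsineMeasure := by
    rw [← setIntegral_congr_fun measurableSet_Ioo e2,
      ← integral_integral_swap (f := fun c y => J (c, y)) hJ, integral_congr_ae e1,
      integral_sub hQint hrint]
    ring
  rw [key]
  refine (enorm_sub_le).trans ?_
  gcongr
  refine (enorm_integral_le_lintegral_enorm _).trans ?_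
  refine setLIntegral_mono' measurableSet_Ioo fun y hy => ?_
  rw [enorm_mul]
  gcongr
  rw [← ofReal_norm, Complex.norm_real,
    Real.norm_of_nonneg (symbolRatioDeriv_nonneg hs.le hq hy.1.le)]
  exact ENNReal.ofReal_le_ofReal (symbolRatioDeriv_le hs.le hs2 hq hk hy.1 hy.2)

end

/-- The integral of `Ψ(k cos θ)` over the angles `θ ∈ (-π, π)`. -/
def circAvg (Ψ : ℝ → ℂ) (k : ℝ) : ℂ := ∫ c, Ψ (k * c) ∂arcsineMeasure

lemma measurable_enorm_circAvg {Ψ : ℝ → ℂ} (hΨ : Continuous Ψ) :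
    Measurable fun k => ‖circAvg Ψ k‖ₑ := by
  have : StronglyMeasurable (circAvg Ψ) :=
    StronglyMeasurable.integral_prod_right' (f := fun q : ℝ × ℝ => Ψ (q.1 * q.2))
      (hΨ.comp (by fun_prop)).stronglyMeasurable
  exact this.measurable.enorm

lemma integral_angle_eq {F : ℝ → ℂ} (hF : StronglyMeasurable F) :
    ∫ θ, F (Real.cos θ) ∂angleMeasure = ∫ c, F c ∂arcsineMeasure := by
  rw [← measurePreserving_cos.map_eq, integral_map Real.measurable_cos.aemeasurable
    hF.aestronglyMeasurable]

/-- The part `|c| < y` of the angular integral is expressed by circular averages of smaller radii;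
the factor `1 / (1 - x²)` of the Abel weight is replaced by `1 / (1 - y²)`, which leaves two averages
over dilations. -/
lemma enorm_integral_symbolRatio_le_dilAvg {s q k : ℝ} (hs : 0 < s) (hs2 : s ≤ 2) (hq : 0 ≤ q)
    (hk : 0 < k) {Ψ : ℝ → ℂ} (hΨ : Continuous Ψ) {B : ℝ} (hB : ∀ c, ‖Ψ c‖ ≤ B) :
    ‖∫ c, (symbolRatio s q k c : ℂ) * Ψ (k * c) ∂arcsineMeasure‖ₑ ≤
      ‖circAvg Ψ k‖ₑ + dilAvg
        (fun y => ENNReal.ofReal (s * y ^ (s - 1) * (2 / Real.pi * (y / Real.sqrt (1 - y ^ 2)))))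
        (dilAvg (fun x => ENNReal.ofReal (x / Real.sqrt (1 - x ^ 2)))
          fun k => ‖circAvg Ψ k‖ₑ) k := by
  refine (enorm_integral_symbolRatio_le hs hs2 hq hk (Q := fun c => Ψ (k * c))
    (hΨ.comp (by fun_prop)) (fun c => hB _)).trans ?_
  refine add_le_add le_rfl (setLIntegral_mono' measurableSet_Ioo fun y hy => ?_)
  have hy0 : 0 < y := hy.1
  have h1y : 0 < 1 - y ^ 2 := by nlinarith [hy.1, hy.2]
  have hsy : 0 < Real.sqrt (1 - y ^ 2) := Real.sqrt_pos.2 h1y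
  have hpi := Real.pi_pos
  have hyp : 0 < y ^ (s - 1) := Real.rpow_pos_of_pos hy0 _
  simp only
  rw [ENNReal.ofReal_mul (p := s * y ^ (s - 1)) (by positivity), mul_assoc]
  refine mul_le_mul' le_rfl ?_
  refine (enorm_setIntegral_arcsineMeasure_le hy.1 hy.2 (Q := fun c => Ψ (k * c))
    (hΨ.comp (by fun_prop)) (fun c => hB _)).trans ?_
  have hN := measurable_enorm_circAvg hΨ
  have e : ∀ x, ∫ c, Ψ (k * (x * c)) ∂arcsineMeasure = circAvg Ψ (k * x) := fun x => by
    simp only [circAvg, mul_assoc]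
  simp only [e]
  rw [lintegral_abelMeasure y (fun x => ‖circAvg Ψ (k * x)‖ₑ) (hN.comp (measurable_const_mul k)),
    ← lintegral_const_mul _ (by
      exact (measurable_abelWeight y).ennreal_ofReal.mul (hN.comp (measurable_const_mul k)))]
  have hsc := lintegral_Ioo_scale hy0 0 1 fun x =>
    ENNReal.ofReal (2 / Real.pi * (x / (Real.sqrt (y ^ 2 - x ^ 2) * Real.sqrt (1 - y ^ 2)))) *
      ‖circAvg Ψ (k * x)‖ₑ
  rw [mul_zero, mul_one] at hsc
  calc _ ≤ ∫⁻ x in Set.Ioo 0 y,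
      ENNReal.ofReal (2 / Real.pi * (x / (Real.sqrt (y ^ 2 - x ^ 2) * Real.sqrt (1 - y ^ 2)))) *
      ‖circAvg Ψ (k * x)‖ₑ := by
        refine setLIntegral_mono' measurableSet_Ioo fun x hx => ?_
        have hx0 : 0 < x := hx.1
        have hyx : 0 < y ^ 2 - x ^ 2 := by nlinarith [hx.1, hx.2]
        have h1x : 1 - y ^ 2 ≤ 1 - x ^ 2 := by linarith
        have hsx : 0 < Real.sqrt (y ^ 2 - x ^ 2) := Real.sqrt_pos.2 hyx
        rw [← mul_assoc, ← ENNReal.ofReal_mul (by positivity)]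
        refine mul_le_mul' (ENNReal.ofReal_le_ofReal ?_) le_rfl
        rw [abelWeight]
        calc 2 * Real.sqrt (1 - y ^ 2) / Real.pi * (x / (Real.sqrt (y ^ 2 - x ^ 2) * (1 - x ^ 2)))
            ≤ 2 * Real.sqrt (1 - y ^ 2) / Real.pi *
              (x / (Real.sqrt (y ^ 2 - x ^ 2) * (1 - y ^ 2))) := by gcongr
          _ = 2 * Real.sqrt (1 - y ^ 2) / Real.pi *
              (x / (Real.sqrt (y ^ 2 - x ^ 2) * Real.sqrt (1 - y ^ 2) ^ 2)) := by
              rw [Real.sq_sqrt h1y.le]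
          _ = _ := by field_simp
    _ = _ := by
        rw [hsc, dilAvg, ← lintegral_const_mul _ (by
          refine Measurable.mul (by fun_prop) (hN.comp (measurable_const_mul (k * y))))]
        refine setLIntegral_congr_fun measurableSet_Ioo fun x hx => ?_
        have hx0 : 0 < x := hx.1
        have h1x : 0 < 1 - x ^ 2 := by nlinarith [hx.1, hx.2]
        have hsx : 0 < Real.sqrt (1 - x ^ 2) := Real.sqrt_pos.2 h1x
        rw [← mul_assoc, ← mul_assoc, ← ENNReal.ofReal_mul hy0.le,
          ← mul_assoc (ENNReal.ofReal (2 / Real.pi * (y / Real.sqrt (1 - y ^ 2)))),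
          ← ENNReal.ofReal_mul (by positivity),
          show y ^ 2 - (y * x) ^ 2 = y ^ 2 * (1 - x ^ 2) by ring, Real.sqrt_mul (by positivity),
          Real.sqrt_sq hy0.le]
        congr 2
        field_simp

lemma ennreal_add_sq_le (a b : ℝ≥0∞) : (a + b) ^ 2 ≤ 2 * (a ^ 2 + b ^ 2) := by
  rcases eq_or_ne a ⊤ with rfl | ha
  · simp
  rcases eq_or_ne b ⊤ with rfl | hb
  · simp
  lift a to NNReal using ha
  lift b to NNReal using hb
  exact_mod_cast add_sq_le (a := a) (b := b)

/-- Multiplication by the ratio of the symbols, between circular averages, is bounded on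
`L²(k dk)`, uniformly in `q`. -/
theorem exists_lintegral_symbolRatio_sq_le {s : ℝ} (hs : 0 ≤ s) (hs2 : s ≤ 2) :
    ∃ C : NNReal, ∀ q : ℝ, 0 ≤ q → ∀ Ψ : ℝ → ℂ, Continuous Ψ → ∀ B : ℝ, (∀ c, ‖Ψ c‖ ≤ B) →
      ∫⁻ k in Set.Ioi 0, ENNReal.ofReal k *
          ‖∫ c, (symbolRatio s q k c : ℂ) * Ψ (k * c) ∂arcsineMeasure‖ₑ ^ 2 ≤
        C * ∫⁻ k in Set.Ioi 0, ENNReal.ofReal k * ‖circAvg Ψ k‖ₑ ^ 2 := by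
  rcases hs.eq_or_lt with rfl | hs0
  · refine ⟨1, fun q hq Ψ hΨ B hB => ?_⟩
    simp [symbolRatio, circAvg]
  set w1 : ℝ → ℝ≥0∞ := fun x => ENNReal.ofReal (x / Real.sqrt (1 - x ^ 2)) with hw1
  set w2 : ℝ → ℝ≥0∞ := fun y =>
    ENNReal.ofReal (s * y ^ (s - 1) * (2 / Real.pi * (y / Real.sqrt (1 - y ^ 2)))) with hw2
  have m1 : Measurable w1 := by fun_prop
  have m2 : Measurable w2 := by fun_prop
  set W1 := ∫⁻ y in Set.Ioo 0 1, w1 y * ENNReal.ofReal y⁻¹ with hW1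
  set W2 := ∫⁻ y in Set.Ioo 0 1, w2 y * ENNReal.ofReal y⁻¹ with hW2
  have f1 : W1 < ⊤ := by
    refine lt_of_le_of_lt (setLIntegral_mono' measurableSet_Ioo fun y hy => ?_)
      lintegral_inv_sqrt_lt_top
    have hy0 : 0 < y := hy.1
    rw [hw1, ← ENNReal.ofReal_mul (by positivity)]
    refine ENNReal.ofReal_le_ofReal (le_of_eq ?_)
    field_simp
  have f2 : W2 < ⊤ := by
    have h := ENNReal.mul_lt_top (a := ENNReal.ofReal (s * (2 / Real.pi))) ENNReal.ofReal_lt_top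
      (lintegral_rpow_div_sqrt_lt_top hs0)
    rw [← lintegral_const_mul _ (by fun_prop)] at h
    refine lt_of_le_of_lt (setLIntegral_mono' measurableSet_Ioo fun y hy => ?_) h
    have hy0 : 0 < y := hy.1
    have hpi := Real.pi_pos
    have hyp : 0 < y ^ (s - 1) := Real.rpow_pos_of_pos hy0 _
    rw [hw2, ← ENNReal.ofReal_mul (by positivity), ← ENNReal.ofReal_mul (by positivity)]
    refine ENNReal.ofReal_le_ofReal (le_of_eq ?_)
    field_simp
  have f : 2 * (1 + W2 ^ 2 * W1 ^ 2) ≠ ⊤ := by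
    refine ENNReal.mul_ne_top (by simp) (ENNReal.add_ne_top.2 ⟨by simp, ?_⟩)
    exact ENNReal.mul_ne_top (ENNReal.pow_ne_top f2.ne) (ENNReal.pow_ne_top f1.ne)
  refine ⟨(2 * (1 + W2 ^ 2 * W1 ^ 2)).toNNReal, fun q hq Ψ hΨ B hB => ?_⟩
  rw [ENNReal.coe_toNNReal f]
  have hN := measurable_enorm_circAvg hΨ
  set h : ℝ → ℝ≥0∞ := fun k => ‖circAvg Ψ k‖ₑ with hh
  set D : ℝ → ℝ≥0∞ := dilAvg w2 (dilAvg w1 h) with hD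
  have mD1 : Measurable (dilAvg w1 h) := measurable_dilAvg m1 hN
  have mD : Measurable D := measurable_dilAvg m2 mD1
  have b1 := lintegral_dilAvg_sq_le m1 hN
  have b2 := lintegral_dilAvg_sq_le m2 mD1
  calc _ ≤ ∫⁻ k in Set.Ioi 0, (2 * (ENNReal.ofReal k * h k ^ 2) +
        2 * (ENNReal.ofReal k * D k ^ 2)) := by
        refine setLIntegral_mono' measurableSet_Ioi fun k hk => ?_
        have h1 := enorm_integral_symbolRatio_le_dilAvg hs0 hs2 hq hk hΨ hB
        have h2 : (h k + D k) ^ 2 ≤ 2 * h k ^ 2 + 2 * D k ^ 2 := by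
          rw [← mul_add]
          exact ennreal_add_sq_le _ _
        calc _ ≤ ENNReal.ofReal k * (h k + D k) ^ 2 := by gcongr
          _ ≤ ENNReal.ofReal k * (2 * h k ^ 2 + 2 * D k ^ 2) := by gcongr
          _ = _ := by ring
    _ = 2 * (∫⁻ k in Set.Ioi 0, ENNReal.ofReal k * h k ^ 2) +
        2 * ∫⁻ k in Set.Ioi 0, ENNReal.ofReal k * D k ^ 2 := by
        rw [lintegral_add_left (by fun_prop), lintegral_const_mul _ (by fun_prop),
          lintegral_const_mul _ (by fun_prop)]
    _ ≤ 2 * (∫⁻ k in Set.Ioi 0, ENNReal.ofReal k * h k ^ 2) +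
        2 * (W2 ^ 2 * (W1 ^ 2 * ∫⁻ k in Set.Ioi 0, ENNReal.ofReal k * h k ^ 2)) := by
        gcongr
        exact b2.trans (by gcongr)
    _ = _ := by ring

/-! ### Test functions on the half-plane -/

/-- A complex test function, as a Schwartz function. -/
def IsTest.toSchwartz {V : Type} [NormedAddCommGroup V] [NormedSpace ℝ V] {U : Set V} {φ : V → ℂ}
    (hφ : IsTest U φ) : SchwartzMap V ℂ :=
  hφ.2.toSchwartzMap hφ.1

lemma IsTest.coe_toSchwartz {V : Type} [NormedAddCommGroup V] [NormedSpace ℝ V] {U : Set V}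
    {φ : V → ℂ} (hφ : IsTest U φ) : (hφ.toSchwartz : V → ℂ) = φ := rfl

lemma IsTest.integrable {V : Type} [NormedAddCommGroup V] [NormedSpace ℝ V] {U : Set V} {φ : V → ℂ}
    [MeasurableSpace V] [BorelSpace V] {μ : Measure V} [IsFiniteMeasureOnCompacts μ]
    (hφ : IsTest U φ) : Integrable φ μ :=
  hφ.1.continuous.integrable_of_hasCompactSupport hφ.2

lemma IsTest.eq_zero {V : Type} [NormedAddCommGroup V] [NormedSpace ℝ V] {U : Set V} {φ : V → ℂ}
    (hφ : IsTest U φ) {x : V} (hx : x ∉ U) : φ x = 0 :=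
  image_eq_zero_of_notMem_tsupport fun h => hx (hφ.3 h)

lemma contDiff_of_tsupport {V : Type} [NormedAddCommGroup V] [NormedSpace ℝ V] {φ : V → ℂ}
    (h : ∀ x ∈ tsupport φ, ContDiffAt ℝ ∞ φ x) : ContDiff ℝ ∞ φ := by
  refine contDiff_iff_contDiffAt.2 fun x => ?_
  by_cases hx : x ∈ tsupport φ
  · exact h x hx
  · exact (contDiffAt_const (c := (0 : ℂ))).congr_of_eventuallyEq
      (notMem_tsupport_iff_eventuallyEq.1 hx)

lemma IsTest.mul_left {V : Type} [NormedAddCommGroup V] [NormedSpace ℝ V] {U : Set V} {φ a : V → ℂ}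
    (hφ : IsTest U φ) (ha : ∀ x ∈ U, ContDiffAt ℝ ∞ a x) : IsTest U (fun x => a x * φ x) := by
  have hsub : tsupport (fun x => a x * φ x) ⊆ tsupport φ := tsupport_mul_subset_right
  refine ⟨contDiff_of_tsupport fun x hx => ?_, hφ.2.mul_left, hsub.trans hφ.3⟩
  exact (ha x (hφ.3 (hsub hx))).mul hφ.1.contDiffAt

lemma IsTest.rpow_mul {φ : Plane → ℂ} (hφ : IsTest {p : Plane | 0 < p 0} φ) (t : ℝ) :
    IsTest {p : Plane | 0 < p 0} (fun p => ((p 0 ^ t : ℝ) : ℂ) * φ p) := by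
  refine hφ.mul_left fun p hp => ?_
  have hp : 0 < p 0 := hp
  have h0 : ContDiff ℝ ∞ fun p : Plane => p 0 := by fun_prop
  exact Complex.ofRealCLM.contDiff.contDiffAt.comp p
    (h0.contDiffAt.rpow_const_of_ne hp.ne')

lemma norm_axialCoord (x : Space) : ‖axialCoord x‖ = ‖x‖ := by
  have h : 0 ≤ x 0 ^ 2 + x 1 ^ 2 := by positivity
  simp [axialCoord, EuclideanSpace.norm_eq, Fin.sum_univ_three, Real.sq_sqrt h]

/-- The axially symmetric extension of a test function on the half-plane is a test function on the
complement of the axis. -/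
lemma IsTest.axialExt {φ : Plane → ℂ} (hφ : IsTest {p : Plane | 0 < p 0} φ) :
    IsTest {x : Space | 0 < x 0 ^ 2 + x 1 ^ 2} (axialExt φ) := by
  have hsub : tsupport (AxialFrac.axialExt φ) ⊆ axialCoord ⁻¹' tsupport φ :=
    closure_minimal (fun x hx => subset_tsupport φ hx)
      ((isClosed_tsupport φ).preimage continuous_axialCoord)
  have hU : axialCoord ⁻¹' tsupport φ ⊆ {x : Space | 0 < x 0 ^ 2 + x 1 ^ 2} := fun x hx => by
    have : 0 < Real.sqrt (x 0 ^ 2 + x 1 ^ 2) := hφ.3 hx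
    exact Real.sqrt_pos.1 this
  refine ⟨contDiff_of_tsupport fun x hx => ?_, ?_, hsub.trans hU⟩
  · have hx0 : 0 < x 0 ^ 2 + x 1 ^ 2 := hU (hsub hx)
    have h1 : ContDiff ℝ ∞ fun x : Space => x 0 ^ 2 + x 1 ^ 2 := by fun_prop
    have h2 : ContDiffAt ℝ ∞ axialCoord x := by
      rw [contDiffAt_euclidean]
      intro i
      fin_cases i
      · exact h1.contDiffAt.sqrt hx0.ne'
      · exact (by fun_prop : ContDiff ℝ ∞ fun x : Space => x 2).contDiffAt
    exact hφ.1.contDiffAt.comp x h2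
  · have hc : IsCompact (axialCoord ⁻¹' tsupport φ) := by
      refine Metric.isCompact_of_isClosed_isBounded
        ((isClosed_tsupport φ).preimage continuous_axialCoord) ?_
      obtain ⟨R, hR⟩ := hφ.2.isBounded.exists_norm_le
      exact isBounded_iff_forall_norm_le.2 ⟨R, fun x hx => norm_axialCoord x ▸ hR _ hx⟩
    exact hc.of_isClosed_subset (isClosed_tsupport _) hsub

lemma IsTest.weightedExt {φ : Plane → ℂ} (hφ : IsTest {p : Plane | 0 < p 0} φ) :
    IsTest {x : Space | 0 < x 0 ^ 2 + x 1 ^ 2} (weightedExt φ) :=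
  (hφ.rpow_mul _).axialExt

instance : IsFiniteMeasureOnCompacts halfPlaneMeasure := by
  unfold halfPlaneMeasure; infer_instance

/-! ### The Fourier transform in cylindrical coordinates -/

/-- The Fourier transform is unitary in cylindrical coordinates. -/
lemma lintegral_fourier_weightedExt_sq {f : Plane → ℂ} (hf : MemLp f 2 halfPlaneMeasure)
    (hi : Integrable (weightedExt f)) :
    ∫⁻ p, ‖𝓕 (weightedExt f) (planeEmb p)‖ₑ ^ 2 ∂cylMeasure =
      ∫⁻ p, ‖f p‖ₑ ^ 2 ∂halfPlaneMeasure := by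
  have h1 := (isAxial_weightedExt f).fourier.lintegral_sq (continuous_fourier hi)
  rw [← eLpNorm_two_sq, eLpNorm_fourier hi (memLp_weightedExt hf), eLpNorm_two_sq,
    lintegral_weightedExt_sq hf.1] at h1
  exact ((ENNReal.mul_right_inj (by simp [Real.pi_pos]) ENNReal.ofReal_ne_top).1 h1).symm

lemma lintegral_fourierInv_weightedExt_sq {f : Plane → ℂ} (hf : MemLp f 2 halfPlaneMeasure)
    (hi : Integrable (weightedExt f)) :
    ∫⁻ p, ‖𝓕⁻ (weightedExt f) (planeEmb p)‖ₑ ^ 2 ∂cylMeasure =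
      ∫⁻ p, ‖f p‖ₑ ^ 2 ∂halfPlaneMeasure := by
  have h1 := (isAxial_weightedExt f).fourierInv.lintegral_sq (continuous_fourierInv hi)
  rw [← eLpNorm_two_sq, eLpNorm_fourierInv hi (memLp_weightedExt hf), eLpNorm_two_sq,
    lintegral_weightedExt_sq hf.1] at h1
  exact ((ENNReal.mul_right_inj (by simp [Real.pi_pos]) ENNReal.ofReal_ne_top).1 h1).symm

lemma integrable_comp_cylMap {H : Space → ℂ} (hH : Integrable H) :
    Integrable (fun q => H (cylMap q)) (cylMeasure.prod angleMeasure) :=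
  measurePreserving_cylMap.integrable_comp_of_integrable hH

lemma integral_comp_cylMap {H : Space → ℂ} (hH : Integrable H) :
    ∫ q, H (cylMap q) ∂(cylMeasure.prod angleMeasure) = ∫ x, H x := by
  have h := integral_map (μ := cylMeasure.prod angleMeasure)
    continuous_cylMap.measurable.aemeasurable (f := H)
    (by rw [measurePreserving_cylMap.map_eq]; exact hH.1)
  rw [measurePreserving_cylMap.map_eq] at h
  exact h.symm

lemma inner_cylMap_planeEmb (x p : Plane) (θ : ℝ) :
    inner ℝ (cylMap (x, θ)) (planeEmb p) = inner ℝ x (!₂[p 0 * Real.cos θ, p 1] : Plane) := by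
  simp [cylMap, planeEmb, PiLp.inner_apply, Fin.sum_univ_three]
  ring

/-- The Fourier transform on `ℝ³` of an axially symmetric function is a circular average of a
Fourier transform on `ℝ²`. -/
lemma fourierInv_weightedExt_eq_circAvg {φ : Plane → ℂ} (hφ : IsTest {p : Plane | 0 < p 0} φ)
    (p : Plane) :
    𝓕⁻ (weightedExt φ) (planeEmb p) =
      circAvg (fun c => 𝓕⁻ (fun p : Plane => ((p 0 ^ (1 / 2 : ℝ) : ℝ) : ℂ) * φ p) !₂[c, p 1])
        (p 0) := by
  set ψ : Plane → ℂ := fun p => ((p 0 ^ (1 / 2 : ℝ) : ℝ) : ℂ) * φ p with hψ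
  have hψi : Integrable ψ := (hφ.rpow_mul _).integrable
  have hH : Integrable fun v => (Real.fourierChar (inner ℝ v (planeEmb p)) : Circle) •
      weightedExt φ v := by
    have := (Real.fourierIntegral_convergent_iff (μ := volume) (f := weightedExt φ)
      (-planeEmb p)).2 hφ.weightedExt.integrable
    simpa using this
  have hH' := integrable_comp_cylMap hH
  rw [Real.fourierInv_eq, ← integral_comp_cylMap hH, integral_prod_symm _ hH', circAvg]
  have hcont : Continuous fun c : ℝ => 𝓕⁻ ψ !₂[p 0 * c, p 1] :=
    (continuous_fourierInv hψi).comp (by fun_prop)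
  rw [← integral_angle_eq hcont.stronglyMeasurable]
  refine integral_congr_ae (.of_forall fun θ => ?_)
  simp only
  rw [Real.fourierInv_eq, cylMeasure, integral_withDensity_eq_integral_toReal_smul (by fun_prop)
    (.of_forall fun _ => ENNReal.ofReal_lt_top), halfPlaneMeasure,
    ← setIntegral_eq_integral_of_forall_compl_eq_zero (s := {p : Plane | 0 < p 0})
      (f := fun v => (Real.fourierChar (inner ℝ v !₂[p 0 * Real.cos θ, p 1]) : Circle) • ψ v)]
  · refine setIntegral_congr_fun measurableSet_halfPlane fun x hx => ?_
    have hx : 0 < x 0 := hx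
    have e : weightedExt φ (cylMap (x, θ)) = ((x 0 ^ (-(1 / 2) : ℝ) : ℝ) : ℂ) * φ x := by
      change _ * φ (axialCoord _) = _
      rw [axialCoord_cylMap hx]
      exact congrArg (fun p : Plane => ((p 0 ^ (-(1 / 2) : ℝ) : ℝ) : ℂ) * φ x)
        (axialCoord_cylMap hx θ)
    simp only [inner_cylMap_planeEmb, e, hψ, ENNReal.toReal_ofReal hx.le]
    rw [smul_comm]
    congr 1
    rw [Complex.real_smul, ← mul_assoc, ← Complex.ofReal_mul]
    congr 2
    nth_rw 1 [← Real.rpow_one (x 0)]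
    rw [← Real.rpow_add hx]
    norm_num
  · intro x hx
    simp [hψ, hφ.eq_zero hx]

/-- Integration over the lines parallel to the `y` axis. -/
def sliceInt (G : Space → ℂ) (w : Plane) : ℂ := ∫ η, G ((spaceCoord 1).symm (η, w))

lemma integrable_comp_spaceCoord {G : Space → ℂ} (hG : Integrable G) (i : Fin 3) :
    Integrable (fun q => G ((spaceCoord i).symm q)) (volume.prod volume) :=
  (measurePreserving_spaceCoord i).symm.integrable_comp_of_integrable hG

lemma integrable_sliceInt {G : Space → ℂ} (hG : Integrable G) : Integrable (sliceInt G) :=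
  (integrable_comp_spaceCoord hG 1).integral_prod_right

/-- The restriction to a plane of an inverse Fourier transform on `ℝ³` is the inverse Fourier
transform of the integrals over perpendicular lines. -/
lemma fourierInv_planeEmb {G : Space → ℂ} (hG : Integrable G) (p : Plane) :
    𝓕⁻ G (planeEmb p) = 𝓕⁻ (sliceInt G) p := by
  have hH : Integrable fun v => (Real.fourierChar (inner ℝ v (planeEmb p)) : Circle) • G v := by
    have := (Real.fourierIntegral_convergent_iff (μ := volume) (f := G) (-planeEmb p)).2 hG
    simpa using this
  rw [Real.fourierInv_eq, Real.fourierInv_eq,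
    ← (measurePreserving_spaceCoord 1).symm.integral_comp (spaceCoord 1).symm.measurableEmbedding,
    Measure.volume_eq_prod, integral_prod_symm]
  · refine integral_congr_ae (.of_forall fun w => ?_)
    have e : ∀ η, inner ℝ ((spaceCoord 1).symm (η, w)) (planeEmb p) = inner ℝ w p := fun η => by
      rw [spaceCoord_one_symm_apply]
      simp [planeEmb, PiLp.inner_apply, Fin.sum_univ_three]
    simp only [e, sliceInt, Circle.smul_def]
    exact integral_smul (Real.fourierChar (inner ℝ w p) : ℂ) fun η => G ((spaceCoord 1).symm (η, w))
  · exact integrable_comp_spaceCoord hH 1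

/-- Slice theorem: the Fourier transform on `ℝ²` of the profile of an axially symmetric inverse
Fourier transform on `ℝ³`. -/
lemma fourier_axialProfile_ae_eq {G : Space → ℂ} (hG : Integrable G) (hax : IsAxial (𝓕⁻ G))
    (hi : Integrable (axialProfile (𝓕⁻ G))) :
    𝓕 (axialProfile (𝓕⁻ G)) =ᵐ[volume] sliceInt G := by
  have e : axialProfile (𝓕⁻ G) = 𝓕⁻ (sliceInt G) := by
    rw [hax.axialProfile_eq]
    exact funext fun p => fourierInv_planeEmb hG p
  rw [e] at hi ⊢
  exact fourier_fourierInv_ae_eq (integrable_sliceInt hG) hi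

lemma rpow_le_one_add_sq {s : ℝ} (hs : 0 ≤ s) (hs2 : s ≤ 2) {a : ℝ} (ha : 0 ≤ a) :
    a ^ s ≤ 1 + a ^ 2 := by
  rcases le_total a 1 with h | h
  · have := Real.rpow_le_one ha h hs
    nlinarith [sq_nonneg a]
  · have := Real.rpow_le_rpow_of_exponent_le h hs2
    rw [Real.rpow_two] at this
    linarith

/-- The symbol of `D^s` is not smooth at the origin, but has at most quadratic growth. -/
lemma exists_bound_rpow_mul_schwartz {s : ℝ} (hs : 0 ≤ s) (hs2 : s ≤ 2) (χ : SchwartzMap Plane ℂ) :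
    ∃ B, ∀ w, ‖(((2 * Real.pi * ‖w‖) ^ s : ℝ) : ℂ) * χ w‖ ≤ B := by
  obtain ⟨B0, -, h0⟩ := χ.decay 0 0
  obtain ⟨B2, -, h2⟩ := χ.decay 2 0
  refine ⟨B0 + (2 * Real.pi) ^ 2 * B2, fun w => ?_⟩
  have h0 := h0 w
  have h2 := h2 w
  simp only [pow_zero, norm_iteratedFDeriv_zero, one_mul] at h0 h2
  have hp : 0 ≤ 2 * Real.pi * ‖w‖ := by have := Real.pi_pos; positivity
  rw [norm_mul, Complex.norm_real, Real.norm_of_nonneg (by positivity)]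
  calc _ ≤ (1 + (2 * Real.pi * ‖w‖) ^ 2) * ‖χ w‖ := by
        gcongr
        exact rpow_le_one_add_sq hs hs2 hp
    _ = ‖χ w‖ + (2 * Real.pi) ^ 2 * (‖w‖ ^ 2 * ‖χ w‖) := by ring
    _ ≤ _ := by gcongr

lemma symbol_quotient (s : ℝ) {p : Plane} (hp : 0 < p 0) (θ : ℝ) :
    (2 * Real.pi * ‖(!₂[p 0 * Real.cos θ, p 1] : Plane)‖) ^ s *
      (2 * Real.pi * ‖cylMap (p, θ)‖) ^ (-s) = symbolRatio s (p 1 ^ 2) (p 0) (Real.cos θ) := by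
  have hpi := Real.pi_pos
  have e1 : ‖(!₂[p 0 * Real.cos θ, p 1] : Plane)‖ =
      Real.sqrt (p 0 ^ 2 * Real.cos θ ^ 2 + p 1 ^ 2) := by
    simp [EuclideanSpace.norm_eq, mul_pow]
  have e2 : ‖cylMap (p, θ)‖ = Real.sqrt (p 0 ^ 2 + p 1 ^ 2) := by
    rw [← norm_axialCoord, axialCoord_cylMap hp]
    simp [EuclideanSpace.norm_eq]
  have h2 : 0 < p 0 ^ 2 + p 1 ^ 2 := by positivity
  have h2' := Real.sqrt_pos.2 h2
  rw [e1, e2, symbolRatio, Real.rpow_neg (by positivity), ← div_eq_mul_inv,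
    ← Real.div_rpow (by positivity) (by positivity), mul_div_mul_left _ _ (by positivity),
    ← Real.sqrt_div (by positivity), Real.sqrt_eq_rpow, ← Real.rpow_mul (by positivity)]
  congr 1
  ring

/-- The integral of `Ψ(k cos θ, ζ)` over the angles `θ ∈ (-π, π)` at the frequency `p = (k, ζ)`,
weighted by the quotient of the symbols of `D_{rz}^s` and `D_{xyz}^s`. -/
def ratioAvg (s : ℝ) (Ψ : Plane → ℂ) (p : Plane) : ℂ :=
  ∫ c, (symbolRatio s (p 1 ^ 2) (p 0) c : ℂ) * Ψ !₂[p 0 * c, p 1] ∂arcsineMeasure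

lemma stronglyMeasurable_ratioAvg (s : ℝ) {Ψ : Plane → ℂ} (hΨ : Continuous Ψ) :
    StronglyMeasurable (ratioAvg s Ψ) := by
  refine StronglyMeasurable.integral_prod_right' (f := fun q : Plane × ℝ =>
    (symbolRatio s (q.1 1 ^ 2) (q.1 0) q.2 : ℂ) * Ψ !₂[q.1 0 * q.2, q.1 1]) ?_
  have h1 : Measurable fun q : Plane × ℝ => symbolRatio s (q.1 1 ^ 2) (q.1 0) q.2 := by
    unfold symbolRatio
    fun_prop
  have h2 : Continuous fun q : Plane × ℝ => Ψ !₂[q.1 0 * q.2, q.1 1] := hΨ.comp (by fun_prop)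
  exact (Complex.measurable_ofReal.comp h1).stronglyMeasurable.mul h2.stronglyMeasurable

/-- The pairing of the conversion with a test function, on the Fourier side: the slice theorem turns
the planar frequency integral into one over `ℝ³`, where cylindrical coordinates leave the angular
integral `ratioAvg`. -/
lemma integral_conversion_mul {s : ℝ} (hs : 0 ≤ s) (hs2 : s ≤ 2) {f φ : Plane → ℂ}
    (h1 : FracDerivConverges (-s) (weightedExt f)) (h2 : FracDerivConverges s (innerPart s f))
    (hφ : IsTest {p : Plane | 0 < p 0} φ) :
    ∫ p, conversion s f p * φ p ∂halfPlaneMeasure =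
      ∫ p, 𝓕 (weightedExt f) (planeEmb p) *
        ratioAvg s (𝓕⁻ fun p : Plane => ((p 0 ^ (1 / 2 : ℝ) : ℝ) : ℂ) * φ p) p ∂cylMeasure := by
  set ψ : Plane → ℂ := fun p => ((p 0 ^ (1 / 2 : ℝ) : ℝ) : ℂ) * φ p with hψ
  have hψt : IsTest {p : Plane | 0 < p 0} ψ := hφ.rpow_mul _
  set G := fracSymbolMul (-s) (weightedExt f) with hG
  set m : Plane → ℂ := fun w => (((2 * Real.pi * ‖w‖) ^ s : ℝ) : ℂ) * 𝓕⁻ ψ w with hm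
  have hmeas : AEStronglyMeasurable m := by
    refine AEStronglyMeasurable.mul (Measurable.aestronglyMeasurable (by fun_prop)) ?_
    exact (continuous_fourierInv hψt.integrable).aestronglyMeasurable
  obtain ⟨B, hB⟩ : ∃ B, ∀ w, ‖m w‖ ≤ B := by
    have := exists_bound_rpow_mul_schwartz hs hs2 (𝓕⁻ hψt.toSchwartz)
    rwa [SchwartzMap.fourierInv_coe, hψt.coe_toSchwartz] at this
  have hslice : 𝓕 (innerPart s f) =ᵐ[volume] sliceInt G :=
    fourier_axialProfile_ae_eq h1.2 ((isAxial_weightedExt f).fracSymbolMul _).fourierInv h2.1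
  have step1 : ∫ p, conversion s f p * φ p ∂halfPlaneMeasure =
      ∫ p, fracDeriv s (innerPart s f) p * ψ p := by
    rw [halfPlaneMeasure, ← setIntegral_eq_integral_of_forall_compl_eq_zero
      (s := {p : Plane | 0 < p 0}) (f := fun p => fracDeriv s (innerPart s f) p * ψ p)]
    · refine integral_congr_ae (.of_forall fun p => ?_)
      simp only [conversion, hψ]
      ring
    · intro p hp
      simp [hψ, hφ.eq_zero hp]
  let P : Space → Plane := fun ξ => !₂[ξ 0, ξ 2]
  have hPm : Measure.QuasiMeasurePreserving P := by
    have : P = Prod.snd ∘ spaceCoord 1 := by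
      ext ξ i
      fin_cases i <;> rfl
    rw [this]
    exact Measure.quasiMeasurePreserving_snd.comp
      (measurePreserving_spaceCoord 1).quasiMeasurePreserving
  have hH : Integrable fun ξ => m (P ξ) * G ξ :=
    h1.2.bdd_mul (hmeas.comp_quasiMeasurePreserving hPm) (.of_forall fun ξ => hB _)
  have step2 : ∫ p, fracDeriv s (innerPart s f) p * ψ p = ∫ ξ, m (P ξ) * G ξ := by
    rw [fracDeriv, integral_fourierInv_mul h2.2 hψt.integrable,
      ← (measurePreserving_spaceCoord 1).symm.integral_comp
        (spaceCoord 1).symm.measurableEmbedding, Measure.volume_eq_prod, integral_prod_symm]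
    · refine integral_congr_ae ?_
      filter_upwards [hslice] with w hw
      have e : ∀ η, P ((spaceCoord 1).symm (η, w)) = w := fun η => by
        rw [spaceCoord_one_symm_apply]
        ext i
        fin_cases i <;> rfl
      simp only [e]
      rw [integral_const_mul, fracSymbolMul, hw]
      simp only [hm, sliceInt]
      ring
    · exact integrable_comp_spaceCoord hH 1
  rw [step1, step2, ← integral_comp_cylMap hH, integral_prod _ (integrable_comp_cylMap hH)]
  refine integral_congr_ae ?_
  filter_upwards [ae_cylMeasure_pos] with p hp
  have e : ∀ θ, m (P (cylMap (p, θ))) * G (cylMap (p, θ)) = 𝓕 (weightedExt f) (planeEmb p) *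
      ((symbolRatio s (p 1 ^ 2) (p 0) (Real.cos θ) : ℂ) * 𝓕⁻ ψ !₂[p 0 * Real.cos θ, p 1]) := by
    intro θ
    have hP : P (cylMap (p, θ)) = !₂[p 0 * Real.cos θ, p 1] := rfl
    rw [hP, ← symbol_quotient s hp θ]
    simp only [hm, hG, fracSymbolMul, (isAxial_weightedExt f).fourier.cylMap hp]
    push_cast
    ring
  simp only [e]
  rw [integral_const_mul, ratioAvg]
  congr 1
  refine integral_angle_eq (F := fun c => (symbolRatio s (p 1 ^ 2) (p 0) c : ℂ) *
    𝓕⁻ ψ !₂[p 0 * c, p 1]) ?_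
  have m1 : Measurable fun c => symbolRatio s (p 1 ^ 2) (p 0) c := by
    unfold symbolRatio
    fun_prop
  have m2 : Continuous fun c : ℝ => 𝓕⁻ ψ !₂[p 0 * c, p 1] :=
    (continuous_fourierInv hψt.integrable).comp (by fun_prop)
  exact (Complex.measurable_ofReal.comp m1).stronglyMeasurable.mul m2.stronglyMeasurable

lemma exists_lintegral_ratioAvg_sq_le {s : ℝ} (hs : 0 ≤ s) (hs2 : s ≤ 2) :
    ∃ C : NNReal, ∀ φ : Plane → ℂ, IsTest {p : Plane | 0 < p 0} φ →
      ∫⁻ p, ‖ratioAvg s (𝓕⁻ fun p : Plane => ((p 0 ^ (1 / 2 : ℝ) : ℝ) : ℂ) * φ p) p‖ₑ ^ 2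
        ∂cylMeasure ≤ C * ∫⁻ p, ‖φ p‖ₑ ^ 2 ∂halfPlaneMeasure := by
  obtain ⟨C, hC⟩ := exists_lintegral_symbolRatio_sq_le hs hs2
  refine ⟨C, fun φ hφ => ?_⟩
  set ψ : Plane → ℂ := fun p => ((p 0 ^ (1 / 2 : ℝ) : ℝ) : ℂ) * φ p with hψ
  have hψt : IsTest {p : Plane | 0 < p 0} ψ := hφ.rpow_mul _
  have hΨ : Continuous (𝓕⁻ ψ) := continuous_fourierInv hψt.integrable
  obtain ⟨B, hB⟩ : ∃ B, ∀ w, ‖𝓕⁻ ψ w‖ ≤ B := by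
    obtain ⟨B, -, h⟩ := (𝓕⁻ hψt.toSchwartz).decay 0 0
    simp only [pow_zero, norm_iteratedFDeriv_zero, one_mul, SchwartzMap.fourierInv_coe,
      hψt.coe_toSchwartz] at h
    exact ⟨B, h⟩
  have hM : Measurable fun p => ‖ratioAvg s (𝓕⁻ ψ) p‖ₑ ^ 2 :=
    (stronglyMeasurable_ratioAvg s hΨ).measurable.enorm.pow_const 2
  have hNm : Measurable fun p => ‖𝓕⁻ (weightedExt φ) (planeEmb p)‖ₑ ^ 2 :=
    ((continuous_fourierInv hφ.weightedExt.integrable).comp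
      continuous_planeEmb).measurable.enorm.pow_const 2
  have hr : Measurable fun p : Plane => ENNReal.ofReal (p 0) := by fun_prop
  have hrM : Measurable fun p : Plane => ENNReal.ofReal (p 0) * ‖ratioAvg s (𝓕⁻ ψ) p‖ₑ ^ 2 :=
    hr.mul hM
  have hrN : Measurable fun p : Plane =>
      ENNReal.ofReal (p 0) * ‖𝓕⁻ (weightedExt φ) (planeEmb p)‖ₑ ^ 2 := hr.mul hNm
  rw [← lintegral_fourierInv_weightedExt_sq hφ.memLp hφ.weightedExt.integrable,
    lintegral_cylMeasure hM.aemeasurable, lintegral_cylMeasure hNm.aemeasurable,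
    lintegral_halfPlaneMeasure hrM, lintegral_halfPlaneMeasure hrN,
    ← lintegral_const_mul' _ _ ENNReal.coe_ne_top]
  refine lintegral_mono fun z => ?_
  have := hC (z ^ 2) (sq_nonneg z) (fun c => 𝓕⁻ ψ !₂[c, z]) (hΨ.comp (by fun_prop)) B
    (fun c => hB _)
  simpa only [ratioAvg, fourierInv_weightedExt_eq_circAvg hφ, PiLp.toLp_apply,
    Matrix.cons_val_zero, Matrix.cons_val_one] using! this

/-- The conversion is bounded in `L²`, in the weak sense. -/
theorem exists_norm_integral_conversion_mul_le {s : ℝ} (hs : 0 ≤ s) (hs2 : s ≤ 2) :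
    ∃ C : ℝ, 0 ≤ C ∧ ∀ f φ : Plane → ℂ, MemLp f 2 halfPlaneMeasure →
      FracDerivConverges (-s) (weightedExt f) → FracDerivConverges s (innerPart s f) →
      IsTest {p : Plane | 0 < p 0} φ →
      ‖∫ p, conversion s f p * φ p ∂halfPlaneMeasure‖ ≤ C * (eLpNorm f 2 halfPlaneMeasure).toReal *
        (eLpNorm φ 2 halfPlaneMeasure).toReal := by
  obtain ⟨C, hC⟩ := exists_lintegral_ratioAvg_sq_le hs hs2
  refine ⟨Real.sqrt C, Real.sqrt_nonneg _, fun f φ hf h1 h2 hφ => ?_⟩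
  have hφ2 : MemLp φ 2 halfPlaneMeasure := hφ.memLp
  rw [integral_conversion_mul hs hs2 h1 h2 hφ]
  have hC := hC φ hφ
  set ψ : Plane → ℂ := fun p => ((p 0 ^ (1 / 2 : ℝ) : ℝ) : ℂ) * φ p with hψ
  have hψt : IsTest {p : Plane | 0 < p 0} ψ := hφ.rpow_mul _
  have hΨ : Continuous (𝓕⁻ ψ) := continuous_fourierInv hψt.integrable
  have m1 : Measurable fun p => ‖𝓕 (weightedExt f) (planeEmb p)‖ₑ :=
    ((continuous_fourier h1.1).comp continuous_planeEmb).measurable.enorm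
  have m2 : Measurable fun p => ‖ratioAvg s (𝓕⁻ ψ) p‖ₑ :=
    (stronglyMeasurable_ratioAvg s hΨ).measurable.enorm
  have key : ‖∫ p, 𝓕 (weightedExt f) (planeEmb p) * ratioAvg s (𝓕⁻ ψ) p ∂cylMeasure‖ₑ ^ 2 ≤
      C * (eLpNorm f 2 halfPlaneMeasure ^ 2 * eLpNorm φ 2 halfPlaneMeasure ^ 2) := by
    calc _ ≤ (∫⁻ p, ‖𝓕 (weightedExt f) (planeEmb p)‖ₑ * ‖ratioAvg s (𝓕⁻ ψ) p‖ₑ ∂cylMeasure) ^ 2 := by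
          gcongr
          refine (enorm_integral_le_lintegral_enorm _).trans (le_of_eq ?_)
          exact lintegral_congr fun p => enorm_mul _ _
      _ ≤ _ := lintegral_mul_sq_le m1.aemeasurable m2.aemeasurable
      _ ≤ eLpNorm f 2 halfPlaneMeasure ^ 2 * (C * eLpNorm φ 2 halfPlaneMeasure ^ 2) := by
          rw [lintegral_fourier_weightedExt_sq hf h1.1, eLpNorm_two_sq, eLpNorm_two_sq]
          gcongr
      _ = _ := by ring
  have hfin : C * (eLpNorm f 2 halfPlaneMeasure ^ 2 * eLpNorm φ 2 halfPlaneMeasure ^ 2) ≠ ⊤ :=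
    ENNReal.mul_ne_top ENNReal.coe_ne_top
      (ENNReal.mul_ne_top (ENNReal.pow_ne_top hf.2.ne) (ENNReal.pow_ne_top hφ2.2.ne))
  have key2 := ENNReal.toReal_mono hfin key
  simp only [ENNReal.toReal_pow, toReal_enorm, ENNReal.toReal_mul, ENNReal.coe_toReal] at key2
  refine abs_le_of_sq_le_sq' ?_ (by positivity) |>.2
  rw [mul_pow, mul_pow, Real.sq_sqrt C.coe_nonneg, mul_assoc]
  exact key2

/-! ### Linearity of the conversion -/

section Linear

variable {V : Type} [NormedAddCommGroup V] [InnerProductSpace ℝ V] [FiniteDimensional ℝ V]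
  [MeasurableSpace V] [BorelSpace V] {t : ℝ} {u v : V → ℂ}

lemma fourier_add_of_integrable (hu : Integrable u) (hv : Integrable v) :
    𝓕 (u + v) = 𝓕 u + 𝓕 v :=
  VectorFourier.fourierIntegral_add Real.continuous_fourierChar continuous_inner hu hv

lemma fourier_const_smul (c : ℂ) (u : V → ℂ) : 𝓕 (c • u) = c • 𝓕 u :=
  VectorFourier.fourierIntegral_const_smul _ _ _ u c

lemma fourierInv_add_of_integrable (hu : Integrable u) (hv : Integrable v) :
    𝓕⁻ (u + v) = 𝓕⁻ u + 𝓕⁻ v := by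
  ext w
  simp [Real.fourierInv_eq_fourier_neg, fourier_add_of_integrable hu hv]

lemma fourierInv_const_smul (c : ℂ) (u : V → ℂ) : 𝓕⁻ (c • u) = c • 𝓕⁻ u := by
  ext w
  simp [Real.fourierInv_eq_fourier_neg, fourier_const_smul]

lemma fracSymbolMul_congr_ae (h : u =ᵐ[volume] v) : fracSymbolMul t u = fracSymbolMul t v := by
  ext w
  simp only [fracSymbolMul, Real.fourier_congr_ae h]

lemma FracDerivConverges.congr_ae (hu : FracDerivConverges t u) (h : u =ᵐ[volume] v) :
    FracDerivConverges t v :=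
  ⟨hu.1.congr h, fracSymbolMul_congr_ae (t := t) h ▸ hu.2⟩

lemma fracDeriv_congr_ae (h : u =ᵐ[volume] v) : fracDeriv t u = fracDeriv t v := by
  rw [fracDeriv, fracDeriv, fracSymbolMul_congr_ae h]

lemma fracSymbolMul_add (hu : Integrable u) (hv : Integrable v) :
    fracSymbolMul t (u + v) = fracSymbolMul t u + fracSymbolMul t v := by
  ext w
  simp only [fracSymbolMul, fourier_add_of_integrable hu hv, Pi.add_apply, mul_add]

lemma fracSymbolMul_const_smul (c : ℂ) (u : V → ℂ) :
    fracSymbolMul t (c • u) = c • fracSymbolMul t u := by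
  ext w
  simp only [fracSymbolMul, fourier_const_smul, Pi.smul_apply, smul_eq_mul]
  ring

lemma FracDerivConverges.add (hu : FracDerivConverges t u) (hv : FracDerivConverges t v) :
    FracDerivConverges t (u + v) :=
  ⟨hu.1.add hv.1, fracSymbolMul_add (t := t) hu.1 hv.1 ▸ hu.2.add hv.2⟩

lemma FracDerivConverges.const_smul (c : ℂ) (hu : FracDerivConverges t u) :
    FracDerivConverges t (c • u) :=
  ⟨hu.1.smul c, fracSymbolMul_const_smul (t := t) c u ▸ hu.2.smul c⟩

lemma fracDeriv_add (hu : FracDerivConverges t u) (hv : FracDerivConverges t v) :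
    fracDeriv t (u + v) = fracDeriv t u + fracDeriv t v := by
  rw [fracDeriv, fracSymbolMul_add hu.1 hv.1, fourierInv_add_of_integrable hu.2 hv.2]
  rfl

lemma fracDeriv_const_smul (c : ℂ) (u : V → ℂ) : fracDeriv t (c • u) = c • fracDeriv t u := by
  rw [fracDeriv, fracSymbolMul_const_smul, fourierInv_const_smul]
  rfl

end Linear

section Conversion

variable {s : ℝ}

lemma weightedExt_coeFn_add (f g : L2rz) :
    weightedExt (f + g : L2rz) =ᵐ[volume] weightedExt f + weightedExt g := by
  refine (weightedExt_congr (Lp.coeFn_add f g)).trans (.of_forall fun x => ?_)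
  simp only [weightedExt, axialExt, Pi.add_apply]
  ring

lemma weightedExt_coeFn_smul (c : ℂ) (f : L2rz) :
    weightedExt (c • f : L2rz) =ᵐ[volume] c • weightedExt f := by
  refine (weightedExt_congr (Lp.coeFn_smul c f)).trans (.of_forall fun x => ?_)
  simp only [weightedExt, axialExt, Pi.smul_apply, smul_eq_mul]
  ring

lemma innerPart_add {f g : L2rz} (hf : f ∈ conversionDomain s) (hg : g ∈ conversionDomain s) :
    innerPart s (f + g : L2rz) = innerPart s f + innerPart s g := by
  ext p
  simp only [innerPart, fracDeriv_congr_ae (weightedExt_coeFn_add f g),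
    fracDeriv_add hf.1 hg.1, axialProfile, Pi.add_apply]

lemma innerPart_smul (c : ℂ) (f : L2rz) :
    innerPart s (c • f : L2rz) = c • innerPart s f := by
  ext p
  simp only [innerPart, fracDeriv_congr_ae (weightedExt_coeFn_smul c f),
    fracDeriv_const_smul, axialProfile, Pi.smul_apply]

lemma conversion_add {f g : L2rz} (hf : f ∈ conversionDomain s) (hg : g ∈ conversionDomain s) :
    conversion s (f + g : L2rz) = conversion s f + conversion s g := by
  ext p
  simp only [conversion, innerPart_add hf hg, fracDeriv_add hf.2 hg.2, Pi.add_apply]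
  ring

lemma conversion_smul (c : ℂ) (f : L2rz) :
    conversion s (c • f : L2rz) = c • conversion s f := by
  ext p
  simp only [conversion, innerPart_smul, fracDeriv_const_smul, Pi.smul_apply, smul_eq_mul]
  ring

lemma add_mem_conversionDomain {f g : L2rz} (hf : f ∈ conversionDomain s)
    (hg : g ∈ conversionDomain s) : f + g ∈ conversionDomain s :=
  ⟨(hf.1.add hg.1).congr_ae (weightedExt_coeFn_add f g).symm,
    innerPart_add hf hg ▸ hf.2.add hg.2⟩

lemma smul_mem_conversionDomain (c : ℂ) {f : L2rz} (hf : f ∈ conversionDomain s) :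
    c • f ∈ conversionDomain s :=
  ⟨(hf.1.const_smul c).congr_ae (weightedExt_coeFn_smul c f).symm,
    innerPart_smul c f ▸ hf.2.const_smul c⟩

end Conversion

/-! ### Density of the domain -/

lemma fracDerivConverges_schwartz {s : ℝ} (hs : 0 ≤ s) (hs2 : s ≤ 2) (χ : SchwartzMap Plane ℂ) :
    FracDerivConverges s χ := by
  refine ⟨χ.integrable, ?_⟩
  have hb : Integrable fun w => ‖𝓕 χ w‖ + (2 * Real.pi) ^ 2 * (‖w‖ ^ 2 * ‖𝓕 χ w‖) :=
    (𝓕 χ).integrable.norm.add (((𝓕 χ).integrable_pow_mul volume 2).const_mul _)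
  refine hb.mono' ?_ (.of_forall fun w => ?_)
  · refine AEStronglyMeasurable.mul (Measurable.aestronglyMeasurable (by fun_prop)) ?_
    exact (continuous_fourier χ.integrable).aestronglyMeasurable
  · have hp : 0 ≤ 2 * Real.pi * ‖w‖ := by have := Real.pi_pos; positivity
    rw [fracSymbolMul, norm_mul, Complex.norm_real, Real.norm_of_nonneg (by positivity)]
    calc _ ≤ (1 + (2 * Real.pi * ‖w‖) ^ 2) * ‖𝓕 (χ : Plane → ℂ) w‖ := by
          gcongr
          exact rpow_le_one_add_sq hs hs2 hp
      _ = _ := by rw [SchwartzMap.fourier_coe]; ring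

/-- `planeEmb` as a linear isometry. -/
def planeEmbₗᵢ : Plane →ₗᵢ[ℝ] Space where
  toFun := planeEmb
  map_add' p q := by
    ext i
    fin_cases i <;> simp [planeEmb]
  map_smul' c p := by
    ext i
    fin_cases i <;> simp [planeEmb]
  norm_map' p := by
    simp [planeEmb, EuclideanSpace.norm_eq, Fin.sum_univ_three]

/-- The restriction of a Schwartz function on `ℝ³` to the plane `y = 0`. -/
def restrictPlane (χ : SchwartzMap Space ℂ) : SchwartzMap Plane ℂ :=
  SchwartzMap.compCLMOfAntilipschitz ℂ (g := planeEmbₗᵢ)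
    planeEmbₗᵢ.toContinuousLinearMap.hasTemperateGrowth planeEmbₗᵢ.isometry.antilipschitz χ

lemma coe_restrictPlane (χ : SchwartzMap Space ℂ) :
    (restrictPlane χ : Plane → ℂ) = χ ∘ planeEmb := rfl

lemma lintegral_cylMeasure_sq {A : Plane → ℂ} (hA : Measurable A) :
    ∫⁻ p, ‖A p‖ₑ ^ 2 ∂cylMeasure =
      ∫⁻ p, ‖((p 0 ^ (1 / 2 : ℝ) : ℝ) : ℂ) * A p‖ₑ ^ 2 ∂halfPlaneMeasure := by
  rw [lintegral_cylMeasure (hA.enorm.pow_const 2).aemeasurable]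
  refine lintegral_congr_ae ?_
  filter_upwards [ae_restrict_mem measurableSet_halfPlane] with p hp
  rw [enorm_mul, mul_pow, enorm_rpow_half_sq hp]

lemma rpow_half_mul_rpow_neg_half {r : ℝ} (hr : 0 < r) :
    ((r ^ (1 / 2 : ℝ) : ℝ) : ℂ) * ((r ^ (-(1 / 2) : ℝ) : ℝ) : ℂ) = 1 := by
  rw [← Complex.ofReal_mul, ← Real.rpow_add hr]
  norm_num

lemma weightedExt_planeEmb (q : Plane → ℂ) {p : Plane} (hp : 0 < p 0) :
    weightedExt q (planeEmb p) = ((p 0 ^ (-(1 / 2) : ℝ) : ℝ) : ℂ) * q p := by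
  rw [weightedExt, axialExt_eq_comp, Function.comp, axialCoord_planeEmb hp.le]

/-- The profile `r^{1/2} h` of an axially symmetric function `h`. -/
def weightedProfile (h : Space → ℂ) (p : Plane) : ℂ :=
  ((p 0 ^ (1 / 2 : ℝ) : ℝ) : ℂ) * h (planeEmb p)

lemma measurable_weightedProfile {h : Space → ℂ} (hc : Continuous h) :
    Measurable (weightedProfile h) :=
  Measurable.mul (by fun_prop) (hc.comp continuous_planeEmb).measurable

lemma weightedExt_weightedProfile {h : Space → ℂ} (hax : IsAxial h) :
    weightedExt (weightedProfile h) =ᵐ[volume] h := by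
  filter_upwards [quasiMeasurePreserving_axialCoord.ae
    (ae_restrict_mem measurableSet_halfPlane)] with x hx
  have hx : 0 < axialCoord x 0 := hx
  change _ * (_ * h (planeEmb (axialCoord x))) = h x
  rw [← hax.eq_planeEmb, ← mul_assoc, mul_comm (Complex.ofReal _)]
  exact (congrArg (· * h x) (rpow_half_mul_rpow_neg_half hx)).trans (one_mul _)

lemma memLp_weightedProfile {h : Space → ℂ} (hc : Continuous h)
    (hfin : ∫⁻ p, ‖h (planeEmb p)‖ₑ ^ 2 ∂cylMeasure < ⊤) :
    MemLp (weightedProfile h) 2 halfPlaneMeasure := by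
  refine ⟨(measurable_weightedProfile hc).aestronglyMeasurable, ?_⟩
  have e : ∀ a : ℝ≥0∞, a < ⊤ ↔ a ^ 2 < ⊤ := fun a => by simp
  rw [e, eLpNorm_two_sq]
  rw [lintegral_cylMeasure_sq (A := fun p => h (planeEmb p))
    (hc.comp continuous_planeEmb).measurable] at hfin
  exact hfin

/-- The functions whose Fourier transform on `ℝ³` is an axially symmetric test function away from
the axis belong to the domain. -/
lemma mem_conversionDomain_of_fourier {s : ℝ} (hs : 0 ≤ s) (hs2 : s ≤ 2) {q : Plane → ℂ}
    (hq : IsTest {p : Plane | 0 < p 0} q) {F : L2rz}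
    (hF : F =ᵐ[halfPlaneMeasure] weightedProfile (𝓕⁻ (weightedExt q))) :
    F ∈ conversionDomain s := by
  set G := hq.weightedExt.toSchwartz with hG
  have hax : IsAxial (𝓕⁻ (weightedExt q)) := (isAxial_weightedExt q).fourierInv
  have hh : weightedExt F =ᵐ[volume] (𝓕⁻ G : SchwartzMap Space ℂ) := by
    refine (weightedExt_congr hF).trans ?_
    rw [SchwartzMap.fourierInv_coe]
    exact weightedExt_weightedProfile hax
  -- Away from the axis the symbol is smooth, so the symbol times `𝓕 (𝓕⁻ G) = G` is a test function.
  have hsm : IsTest {x : Space | 0 < x 0 ^ 2 + x 1 ^ 2}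
      (fun ξ => (((2 * Real.pi * ‖ξ‖) ^ (-s) : ℝ) : ℂ) * weightedExt q ξ) := by
    refine hq.weightedExt.mul_left fun x hx => ?_
    have hx0 : x ≠ 0 := by
      rintro rfl
      simp at hx
    have h1 : ContDiffAt ℝ ∞ (fun ξ : Space => 2 * Real.pi * ‖ξ‖) x :=
      contDiffAt_const.mul (contDiffAt_norm ℝ hx0)
    have h2 : 2 * Real.pi * ‖x‖ ≠ 0 := by
      have := Real.pi_pos
      have := norm_pos_iff.2 hx0
      positivity
    exact Complex.ofRealCLM.contDiff.contDiffAt.comp x (h1.rpow_const_of_ne h2)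
  have hsym : fracSymbolMul (-s) (weightedExt F) = hsm.toSchwartz := by
    rw [fracSymbolMul_congr_ae hh]
    ext ξ
    rw [fracSymbolMul, ← SchwartzMap.fourier_coe, FourierTransform.fourier_fourierInv_eq]
    rfl
  have h1 : FracDerivConverges (-s) (weightedExt F) :=
    ⟨(𝓕⁻ G).integrable.congr hh.symm, hsym ▸ hsm.toSchwartz.integrable⟩
  refine ⟨h1, ?_⟩
  have e : innerPart s F = restrictPlane (𝓕⁻ hsm.toSchwartz) := by
    rw [coe_restrictPlane, SchwartzMap.fourierInv_coe, ← hsym]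
    exact ((isAxial_weightedExt F).fracSymbolMul (-s)).fourierInv.axialProfile_eq
  rw [e]
  exact fracDerivConverges_schwartz hs hs2 _

/-- A test function `φ` is approximated by the inverse Fourier transform of a test function `q` that
is close to the Fourier transform of `φ`. -/
theorem dense_conversionDomain {s : ℝ} (hs : 0 ≤ s) (hs2 : s ≤ 2) :
    Dense (conversionDomain s) := by
  have hd : Dense (testSubmodule {p : Plane | 0 < p 0} halfPlaneMeasure : Set L2rz) :=
    dense_testSubmodule isOpen_halfPlane
  refine dense_closure.1 (hd.mono ?_)
  rintro F ⟨φ, hφ, hF⟩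
  have hφ2 : MemLp φ 2 halfPlaneMeasure := hφ.memLp
  have hφi := hφ.weightedExt.integrable (μ := volume)
  have hgc := continuous_fourier hφi
  have hP : MemLp (weightedProfile (𝓕 (weightedExt φ))) 2 halfPlaneMeasure := by
    refine memLp_weightedProfile hgc ?_
    rw [lintegral_fourier_weightedExt_sq hφ2 hφi, ← eLpNorm_two_sq]
    exact ENNReal.pow_lt_top hφ2.2
  rw [EMetric.mem_closure_iff]
  intro ε hε
  obtain ⟨Q, ⟨q, hq, hQ⟩, hε'⟩ := EMetric.mem_closure_iff.1 (hd (hP.toLp _)) ε hε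
  have hq2 : MemLp q 2 halfPlaneMeasure := hq.memLp
  have hqi := hq.weightedExt.integrable (μ := volume)
  have hhc := continuous_fourierInv hqi
  have hf' : MemLp (weightedProfile (𝓕⁻ (weightedExt q))) 2 halfPlaneMeasure := by
    refine memLp_weightedProfile hhc ?_
    rw [lintegral_fourierInv_weightedExt_sq hq2 hqi, ← eLpNorm_two_sq]
    exact ENNReal.pow_lt_top hq2.2
  refine ⟨hf'.toLp _, mem_conversionDomain_of_fourier hs hs2 hq hf'.coeFn_toLp, ?_⟩
  have eF : F = hφ2.toLp φ := Lp.ext (hF.trans hφ2.coeFn_toLp.symm)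
  have eQ : Q = hq2.toLp q := Lp.ext (hQ.trans hq2.coeFn_toLp.symm)
  rw [eQ, Lp.edist_toLp_toLp] at hε'
  rw [eF, Lp.edist_toLp_toLp]
  refine lt_of_eq_of_lt ?_ hε'
  -- Both distances agree since the transform is unitary in cylindrical coordinates.
  have hax : IsAxial (𝓕⁻ (weightedExt q)) := (isAxial_weightedExt q).fourierInv
  set h : SchwartzMap Space ℂ := 𝓕⁻ hq.weightedExt.toSchwartz with hh
  have hcoe : (h : Space → ℂ) = 𝓕⁻ (weightedExt q) := SchwartzMap.fourierInv_coe _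
  have hw : weightedExt (φ - weightedProfile (𝓕⁻ (weightedExt q))) =ᵐ[volume]
      (hφ.weightedExt.toSchwartz - h : SchwartzMap Space ℂ) := by
    filter_upwards [weightedExt_weightedProfile hax] with x hx
    rw [sub_apply, hcoe, ← hx, hφ.weightedExt.coe_toSchwartz]
    simp only [weightedExt, axialExt, Pi.sub_apply]
    ring
  have hF1 : 𝓕 (weightedExt (φ - weightedProfile (𝓕⁻ (weightedExt q)))) =
      fun ξ => 𝓕 (weightedExt φ) ξ - weightedExt q ξ := by
    ext ξ
    rw [Real.fourier_congr_ae hw, ← SchwartzMap.fourier_coe, sub_eq_add_neg,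
      FourierTransform.fourier_add, FourierTransform.fourier_neg, hh,
      FourierTransform.fourier_fourierInv_eq, ← sub_eq_add_neg]
    rfl
  have hiw : Integrable (weightedExt (φ - weightedProfile (𝓕⁻ (weightedExt q)))) :=
    (SchwartzMap.integrable _).congr hw.symm
  have key := lintegral_fourier_weightedExt_sq (hφ2.sub hf') hiw
  have hAm : Measurable fun p => 𝓕 (weightedExt φ) (planeEmb p) - weightedExt q (planeEmb p) :=
    ((hgc.sub hq.weightedExt.1.continuous).comp continuous_planeEmb).measurable
  simp only [hF1] at key
  rw [lintegral_cylMeasure_sq hAm, ← eLpNorm_two_sq, ← eLpNorm_two_sq] at key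
  rw [← (ENNReal.pow_right_strictMono two_ne_zero).injective key]
  refine eLpNorm_congr_ae ?_
  filter_upwards [ae_restrict_mem measurableSet_halfPlane] with p hp
  rw [weightedExt_planeEmb q hp, mul_sub, ← mul_assoc, rpow_half_mul_rpow_neg_half hp, one_mul]
  rfl

/-! ### The bounded extension -/

lemma exists_Lp_conversion {s : ℝ} (hs : 0 ≤ s) (hs2 : s ≤ 2) :
    ∃ C : ℝ, ∀ f ∈ conversionDomain s, ∃ F : L2rz,
      F =ᵐ[halfPlaneMeasure] conversion s f ∧ ‖F‖ ≤ C * ‖f‖ := by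
  obtain ⟨C, hC0, hC⟩ := exists_norm_integral_conversion_mul_le hs hs2
  refine ⟨C, fun f hf => ?_⟩
  have hcont : Continuous (conversion s f) := by
    refine Continuous.mul ?_ (continuous_fourierInv hf.2.2)
    refine Complex.continuous_ofReal.comp ?_
    exact (by fun_prop : Continuous fun p : Plane => p 0).rpow_const fun _ => .inr (by norm_num)
  exact exists_Lp_of_integral_test_le (μ := volume) isOpen_halfPlane
    (hcont.locallyIntegrable.locallyIntegrableOn _) (mul_nonneg hC0 (norm_nonneg f))
    fun φ hφ => hC f φ (Lp.memLp f) hf.1 hf.2 hφ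

/-- The bounded operator on `L²_{rz}` that extends the conversion: the extension by continuity from
the dense domain. -/
theorem exists_conversion_extension {s : ℝ} (hs0 : 0 ≤ s) (hs2 : s ≤ 2) :
    ∃ U : L2rz →L[ℂ] L2rz, ∀ f ∈ conversionDomain s,
      (U f : Plane → ℂ) =ᵐ[halfPlaneMeasure] conversion s f := by
  have hdense := dense_conversionDomain hs0 hs2
  obtain ⟨C, hC⟩ := exists_Lp_conversion hs0 hs2
  choose! T hT hTC using hC
  let D : Submodule ℂ L2rz :=
    { carrier := conversionDomain s
      add_mem' := add_mem_conversionDomain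
      zero_mem' := by
        obtain ⟨f, hf⟩ := hdense.nonempty
        simpa using smul_mem_conversionDomain 0 hf
      smul_mem' := fun c _ hf => smul_mem_conversionDomain c hf }
  let L : D →ₗ[ℂ] L2rz :=
    { toFun := fun f => T f
      map_add' := fun f g => by
        refine Lp.ext ((hT _ (f + g).2).trans ?_)
        rw [Submodule.coe_add, conversion_add f.2 g.2]
        exact ((hT _ f.2).add (hT _ g.2)).symm.trans (Lp.coeFn_add _ _).symm
      map_smul' := fun c f => by
        refine Lp.ext ((hT _ (c • f).2).trans ?_)
        rw [Submodule.coe_smul, conversion_smul]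
        exact ((hT _ f.2).const_smul c).symm.trans (Lp.coeFn_smul _ _).symm }
  refine ⟨L.extendOfNorm D.subtype, fun f hf => ?_⟩
  have hr : DenseRange D.subtype := by
    rw [DenseRange, Submodule.coe_subtype, Subtype.range_coe]
    exact hdense
  have := LinearMap.extendOfNorm_eq (f := L) hr ⟨C, fun x => hTC x x.2⟩ ⟨f, hf⟩
  rw [Submodule.subtype_apply] at this
  rw [this]
  exact hT f hf

end AxialFrac

end

/-- For `0 ≤ s ≤ 2` the composition `r^{1/2} D_{rz}^s D_{xyz}^{-s} r^{-1/2}` is densely defined on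
`L²_{rz}` and is (extends to) a bounded operator on `L²_{rz}`. -/
theorem lemma16p2 (s : ℝ) (hs0 : 0 ≤ s) (hs2 : s ≤ 2) :
    Dense (AxialFrac.conversionDomain s) ∧
    ∃ U : AxialFrac.L2rz →L[ℂ] AxialFrac.L2rz,
      ∀ f ∈ AxialFrac.conversionDomain s,
        (U f : AxialFrac.Plane → ℂ)
          =ᵐ[AxialFrac.halfPlaneMeasure] AxialFrac.conversion s f := by
  exact ⟨AxialFrac.dense_conversionDomain hs0 hs2, AxialFrac.exists_conversion_extension hs0 hs2⟩
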